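/- \textbf{The language.} Types are $T ::= \mathtt{real} \mid \mathtt{unit} \mid T\times U$. Fix operation symbols $\mathrm{op}:T\to U$ and predicate symbols $\mathrm{pred}:T$; every $\mathrm{op}:T\to U$ comes with an operation symbol $\mathrm{op}_r:T\times U\to T$. Terms $M$ and boolean terms $B$ (up to $\alpha$-equivalence) are \[M ::= x \mid r\,(r\in\mathbb R) \mid M+N \mid \mathrm{op}(M) \mid \mathtt{let}\,x{:}T=M\,\mathtt{in}\,N \mid * \mid \langle M,N\rangle \mid \mathtt{fst}(M) \mid \mathtt{snd}(M) \mid \mathtt{if}\,B\,\mathtt{then}\,M\,\mathtt{else}\,N \mid \mathtt{letrec}\,f(x{:}T){:}U=M\,\mathtt{in}\,N \mid f(M) \mid \mathtt{rd}(x{:}T.\,N)(L,M),\] \[B ::= \mathrm{pred}(M)\mid \mathtt{true}\mid\mathtt{false},\] with the evident simple typing judgements $\Phi\mid\Gamma\vdash M:T$ and $\Phi\mid\Gamma\vdash B$, where $\Gamma$ types ordinary variables and $\Phi$ types function variables by $f:T\to U$. Addition is only at type $\mathtt{real}$; in $\mathtt{letrec}$ the body $M$ satisfies $\Phi[f:T\to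 U]\mid x:T\vdash M:U$, so it has no free ordinary variable besides $x$; and $\Phi\mid\Gamma\vdash\mathtt{rd}(x{:}T.N)(L,M):T$ if $\Phi\mid\Gamma[x{:}T]\vdash N:U$, $\Phi\mid\Gamma\vdash L:T$, and $\Phi\mid\Gamma\vdash M:U$. Values are $V ::= x\mid r\mid *\mid\langle V,W\rangle$; boolean values are $\mathtt{true},\mathtt{false}$; trace terms are the terms without conditionals, $\mathtt{letrec}$, function applications, and $\mathtt{rd}$. Partial evaluation functions $\mathrm{ev}$, $\mathrm{bev}$ map an operation (predicate) symbol and a closed value of its argument type to a closed value of its result type (a boolean value). A value environment $\rho:\Gamma$ assigns to each variable of $\Gamma$ a closed value of its type; $\rho(V)$ is the result of substitution. Function environments $\varphi:\Phi$ and closures are defined mutually: $\varphi$ is a finite map assigning to each $f:T\to U$ in $\Phi$ a closure of type $T\to U$, and $\langle\varphi,f(x{:}T){:}U.M\rangle$ is a closure of type $T\to U$ if $\varphi:\Phi$ and $\Phi[f:T\to U]\mid x:T\vdash M:U$. \textbf{Operational semantics.} Evaluation contexts are \[E ::= [\,]\mid E+N\mid V+E\mid \mathrm{op}(E)\mid \mathtt{let}\,x{:}T=E\,\mathtt{in}\,N\mid\langle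 E,N\rangle\mid\langle V,E\rangle\mid\mathtt{fst}(E)\mid\mathtt{snd}(E)\mid \mathtt{if}\,E_{\mathtt{bool}}\,\mathtt{then}\,M\,\mathtt{else}\,N\mid f(E)\mid\mathtt{rd}(x{:}T.N)(E,M)\mid\mathtt{rd}(x{:}T.N)(V,E),\] $E_{\mathtt{bool}} ::= [\,]\mid\mathrm{pred}(E)$. Redexes $R$ are $V+W$, $\mathrm{op}(V)$, $\mathtt{let}\,x{:}T=V\,\mathtt{in}\,N$, $\mathtt{fst}(V)$, $\mathtt{snd}(V)$, $\mathtt{if}\,V_{\mathtt{bool}}\,\mathtt{then}\,M\,\mathtt{else}\,N$ with a boolean value $V_{\mathtt{bool}}$, $\mathtt{letrec}$ terms, $f(V)$, $\mathtt{rd}(x{:}T.N)(V,W)$; boolean redexes are $\mathrm{pred}(V)$. Ordinary evaluation $\varphi\mid\rho\vdash M\Rightarrow V$ (to closed values) and $\varphi\mid\rho\vdash B\Rightarrow V_{\mathtt{bool}}$, and symbolic evaluation $\varphi\mid\rho\vdash M\rightsquigarrow C$ (to trace terms) are the least relations such that the following hold. Ordinary: $V\Rightarrow\rho(V)$; $\mathtt{true}\Rightarrow\mathtt{true}$;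 $\mathtt{false}\Rightarrow\mathtt{false}$; $V+W\Rightarrow r+s$ if $V\Rightarrow r$, $W\Rightarrow s$; $\mathrm{op}(V)\Rightarrow\mathrm{ev}(\mathrm{op},V')$ and $\mathrm{pred}(V)\Rightarrow\mathrm{bev}(\mathrm{pred},V')$, if $V\Rightarrow V'$ and the right-hand side is defined; $\mathtt{let}\,x{:}T=V\,\mathtt{in}\,N\Rightarrow W$ if $V\Rightarrow V'$ and $\varphi\mid\rho[V'/x]\vdash N\Rightarrow W$; $\mathtt{fst}(V)\Rightarrow W_1$ and $\mathtt{snd}(V)\Rightarrow W_2$ if $V\Rightarrow\langle W_1,W_2\rangle$; a conditional redex evaluates to what the selected branch evaluates to; $\mathtt{letrec}\,f(x{:}T){:}U=M\,\mathtt{in}\,N\Rightarrow V$ if $\varphi[\langle\varphi,f(x{:}T){:}U.M\rangle/f]\mid\rho\vdash N\Rightarrow V$; $f(V)\Rightarrow W$ if $\varphi(f)=\langle\varphi',f(x{:}T){:}U.M\rangle$, $V\Rightarrow V'$ and $\varphi'[\varphi(f)/f]\mid\{x\mapsto V'\}\vdash M\Rightarrow W$; $\mathtt{rd}(x{:}T.N)(V,W)\Rightarrow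 X$ if $\mathtt{rd}(x{:}T.N)(V,W)\rightsquigarrow C$ and $C\Rightarrow X$; for $E$ a nontrivial context or boolean context and $x$ fresh, $E[R]\Rightarrow W$ if $R\Rightarrow V$ and $\varphi\mid\rho[V/x]\vdash E[x]\Rightarrow W$; and $E[R_{\mathtt{bool}}]\Rightarrow W$ if $R_{\mathtt{bool}}\Rightarrow V_{\mathtt{bool}}$ and $E[V_{\mathtt{bool}}]\Rightarrow W$. Symbolic: $V$, $V+W$, $\mathrm{op}(V)$, $\mathtt{fst}(V)$, $\mathtt{snd}(V)$ symbolically evaluate to themselves; $\mathtt{let}\,x{:}T=V\,\mathtt{in}\,N\rightsquigarrow\mathtt{let}\,x{:}T=V\,\mathtt{in}\,C$ if $V\Rightarrow V'$ and $\varphi\mid\rho[V'/x]\vdash N\rightsquigarrow C$; conditional and $\mathtt{letrec}$ redexes as in ordinary evaluation, with $\rightsquigarrow$ for $\Rightarrow$; $f(V)\rightsquigarrow\mathtt{let}\,x{:}T=V\,\mathtt{in}\,C$ if $\varphi(f)=\langle\varphi',f(x{:}T){:}U.M\rangle$, $V\Rightarrow V'$, and $\varphi'[\varphi(f)/f]\mid\{x\mapsto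 V'\}\vdash M\rightsquigarrow C$; $\mathtt{rd}(x{:}T.N)(V,W)\rightsquigarrow W.\mathcal R_V(x{:}T.C)$ if $V\Rightarrow V'$ and $\varphi\mid\rho[V'/x]\vdash N\rightsquigarrow C$; for $E$ nontrivial and $x$ fresh, $E[R]\rightsquigarrow\mathtt{let}\,x=C\,\mathtt{in}\,D$ if $R\rightsquigarrow C$, $C\Rightarrow V$, and $\varphi\mid\rho[V/x]\vdash E[x]\rightsquigarrow D$; and $E[R_{\mathtt{bool}}]\rightsquigarrow C$ if $R_{\mathtt{bool}}\Rightarrow V_{\mathtt{bool}}$ and $E[V_{\mathtt{bool}}]\rightsquigarrow C$. Here the trace term $W.\mathcal R_V(x{:}T.C)$ is defined by recursion on the trace term $C$ (all bound variables fresh; $0_T$ and $+_T$ are the componentwise zero and addition, where $C+_{\mathtt{unit}}D$ is $\mathtt{let}\,x=C\,\mathtt{in}\,\mathtt{let}\,y=D\,\mathtt{in}\,*$, $C+_{T\times U}D$ is $\mathtt{let}\,\langle x_1,x_2\rangle=C\,\mathtt{in}\,\mathtt{let}\,\langle y_1,y_2\rangle=D\,\mathtt{in}\,\langle x_1+_Ty_1,x_2+_Uy_2\rangle$,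 and $\mathtt{let}\,\langle y,z\rangle=C\,\mathtt{in}\,D$ is $\mathtt{let}\,p=C\,\mathtt{in}\,\mathtt{let}\,y=\mathtt{fst}(p)\,\mathtt{in}\,\mathtt{let}\,z=\mathtt{snd}(p)\,\mathtt{in}\,D$): it is $W$ for $C=x$; $0_T$ for $C$ another variable, a constant, or $*$; $W.\mathcal R_V(x.D)+_TW.\mathcal R_V(x.E)$ for $D+E$; $\mathtt{let}\,x=V\,\mathtt{in}\,\mathtt{let}\,y=\mathrm{op}_r\langle D,W\rangle\,\mathtt{in}\,y.\mathcal R_V(x.D)$ for $\mathrm{op}(D)$; $\mathtt{let}\,x=V\,\mathtt{in}\,\mathtt{let}\,y=D\,\mathtt{in}\,W.\mathcal R_V(x.E)+_T(\mathtt{let}\,\bar y=W.\mathcal R_y(y.E)\,\mathtt{in}\,\bar y.\mathcal R_V(x.D))$ for $\mathtt{let}\,y=D\,\mathtt{in}\,E$; $\mathtt{let}\,\langle y,z\rangle=W\,\mathtt{in}\,y.\mathcal R_V(x.D)+_Tz.\mathcal R_V(x.E)$ for $\langle D,E\rangle$; $\mathtt{let}\,x=V\,\mathtt{in}\,\mathtt{let}\,y=D\,\mathtt{in}\,\langle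 W,0\rangle.\mathcal R_V(x.D)$ for $\mathtt{fst}(D)$, and the same with $\langle 0,W\rangle$ for $\mathtt{snd}(D)$. \textbf{Denotational semantics.} $[\![T]\!]=\mathbb R^{|T|}$, with $|\mathtt{real}|=1$, $|\mathtt{unit}|=0$, $|T\times U|=|T|+|U|$. For a partial function $f:\mathbb R^n\rightharpoonup\mathbb R^m$, $\mathrm d^r_{\mathbf x}(f)(\mathbf y)\simeq \mathrm J_{\mathbf x}(f)^t\mathbf y$, defined iff $f$ is defined near $\mathbf x$ and its Jacobian $\mathrm J_{\mathbf x}(f)$ (the matrix of partial derivatives) exists. Assume given smooth partial functions $[\![\mathrm{op}]\!]:[\![T]\!]\rightharpoonup[\![U]\!]$ and continuous partial functions $[\![\mathrm{pred}]\!]:[\![T]\!]\rightharpoonup\{\mathit{tt},\mathit{ff}\}$ (all with open domain) with $[\![\mathrm{op}]\!]([\![V]\!])\simeq[\![\mathrm{ev}(\mathrm{op},V)]\!]$ and $[\![\mathrm{pred}]\!]([\![V]\!])\simeq[\![\mathrm{bev}(\mathrm{pred},V)]\!]$ for closed values $V$, and $[\![\mathrm{op}_r]\!](\mathbf x,\mathbf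 y)\simeq\mathrm d^r_{\mathbf x}([\![\mathrm{op}]\!])(\mathbf y)$. The partial denotation $[\![M]\!]\phi\gamma$ (and similarly $[\![B]\!]\phi\gamma$), for $\phi$ assigning smooth partial functions to the function variables and $\gamma$ assigning vectors to the ordinary variables, is the standard strict (call-by-value) compositional one, with \[[\![\mathtt{letrec}\,f(x{:}T){:}U=M\,\mathtt{in}\,N]\!]\phi\gamma\simeq[\![N]\!]\bigl(\phi[\mu\alpha.\,\lambda a.\,[\![M]\!](\phi[\alpha/f])\{x\mapsto a\}\,/f]\bigr)\gamma,\] \[[\![\mathtt{rd}(x{:}T.N)(L,M)]\!]\phi\gamma\simeq\mathrm d^r_{[\![L]\!]\phi\gamma}\bigl(a\mapsto[\![N]\!]\phi(\gamma[a/x])\bigr)\bigl([\![M]\!]\phi\gamma\bigr),\] where $\mu\alpha$ is the least fixed point among the smooth partial functions with open domain $[\![T]\!]\rightharpoonup[\![U]\!]$, ordered by inclusion of graphs. Further $[\![\rho]\!](x)=[\![\rho(x)]\!]$, $[\![\varphi]\!](f)=[\![\varphi(f)]\!]$, and $[\![\langle\varphi,f(x{:}T){:}U.M\rangle]\!]=\mu\alpha.\,\lambda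 a.\,[\![M]\!]([\![\varphi]\!][\alpha/f])\{x\mapsto a\}$. \textbf{Theorem (Operational completeness).} Let $\varphi:\Phi$ and $\rho:\Gamma$. \begin{enumerate} \item If $\Phi\mid\Gamma\vdash M:T$ and $[\![M]\!][\![\varphi]\!][\![\rho]\!]$ is defined, then there is a closed value $V$ with $\varphi\mid\rho\vdash M\Rightarrow V$. Likewise, if $\Phi\mid\Gamma\vdash B$ and $[\![B]\!][\![\varphi]\!][\![\rho]\!]$ is defined, then there is a boolean value $V_{\mathtt{bool}}$ with $\varphi\mid\rho\vdash B\Rightarrow V_{\mathtt{bool}}$. \item If $\Phi\mid\Gamma\vdash M:T$ and $[\![M]\!][\![\varphi]\!][\![\rho]\!]$ is defined, then there is a trace term $C$ with $\varphi\mid\rho\vdash M\rightsquigarrow C$. \end{enumerate} -/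

import Mathlib

/-!
A first-order language with recursion and a reverse-mode differentiation construct: syntax,
operational semantics (ordinary and symbolic evaluation), and denotational semantics.

Terms are taken up to renaming of bound variables and are represented by well-typed de Bruijn
terms: an element of `Tm S Φ Γ (.ty T)` is a term `M` with `Φ | Γ ⊢ M : T`, an element of
`Tm S Φ Γ .bool` is a boolean term `B` with `Φ | Γ ⊢ B`.  Environments are lists whose head is the
most recently bound variable, so that `T :: Γ` is `Γ[x : T]`.
-/

universe u

open scoped ContDiff Topology

namespace DiffLang

noncomputable section

/-! ### Types, variables, environments -/

/-- `T ::= real | unit | T × U`. -/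
inductive Ty : Type
  | real : Ty
  | unit : Ty
  | prod : Ty → Ty → Ty

/-- The two syntactic categories: terms of a given type, and boolean terms. -/
inductive Srt : Type
  | ty : Ty → Srt
  | bool : Srt

/-- Typed variables (positions in an environment).  Ordinary variables are `Var Γ T` with
`Γ : List Ty`; function variables `f : T → U` are `Var Φ (T, U)` with `Φ : List (Ty × Ty)`. -/
inductive Var {α : Type} : List α → α → Type
  | z {Γ : List α} {a : α} : Var (a :: Γ) a
  | s {Γ : List α} {a b : α} : Var Γ a → Var (b :: Γ) a

/-- Renamings of ordinary variables. -/
abbrev Ren (Γ Δ : List Ty) : Type := ∀ T : Ty, Var Γ T → Var Δ T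

/-- Extension of a renaming under a binder. -/
def Ren.lift {Γ Δ : List Ty} (θ : Ren Γ Δ) (T : Ty) : Ren (T :: Γ) (T :: Δ)
  | _, .z => .z
  | _, .s v => .s (θ _ v)

/-- Weakenings by one, two, and three variables. -/
def wk1 {Γ : List Ty} (A : Ty) : Ren Γ (A :: Γ) := fun _ v => .s v
def wk2 {Γ : List Ty} (A B : Ty) : Ren Γ (B :: A :: Γ) := fun _ v => .s (.s v)
def wk3 {Γ : List Ty} (A B C : Ty) : Ren Γ (C :: B :: A :: Γ) := fun _ v => .s (.s (.s v))

/-- The only renaming out of the empty environment. -/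
def Ren.nil {Γ : List Ty} : Ren [] Γ := fun _ v => nomatch v

/-! ### Values -/

/-- Values `V ::= x | r | * | ⟨V, W⟩`, possibly with free variables in `Γ`. -/
inductive Val (Γ : List Ty) : Ty → Type
  | var {T : Ty} : Var Γ T → Val Γ T
  | real : ℝ → Val Γ .real
  | unit : Val Γ .unit
  | pair {T U : Ty} : Val Γ T → Val Γ U → Val Γ (.prod T U)

/-- Closed values of type `T`. -/
abbrev ClosedVal (T : Ty) : Type := Val [] T

/-- Closed values of a type, resp. boolean values. -/
abbrev Srt.Value : Srt → Type
  | .ty T => ClosedVal T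
  | .bool => Bool

def Val.rename {Γ Δ : List Ty} (θ : Ren Γ Δ) : {T : Ty} → Val Γ T → Val Δ T
  | _, .var v => .var (θ _ v)
  | _, .real r => .real r
  | _, .unit => .unit
  | _, .pair V W => .pair (V.rename θ) (W.rename θ)

/-- The value `0_T`. -/
def Val.zero {Γ : List Ty} : (T : Ty) → Val Γ T
  | .real => .real 0
  | .unit => .unit
  | .prod T U => .pair (Val.zero T) (Val.zero U)

/-- Value environments `ρ : Γ`, assigning a closed value of the right type to each variable. -/
abbrev VEnv (Γ : List Ty) : Type := ∀ T : Ty, Var Γ T → ClosedVal T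

/-- The value environment `ρ[V/x]`. -/
def VEnv.cons {Γ : List Ty} {T : Ty} (V : ClosedVal T) (ρ : VEnv Γ) : VEnv (T :: Γ)
  | _, .z => V
  | _, .s v => ρ _ v

/-- The empty value environment. -/
def VEnv.nil : VEnv [] := fun _ v => nomatch v

/-- `ρ(V)`: the closed value obtained from `V` by substitution. -/
def Val.subst {Γ : List Ty} (ρ : VEnv Γ) : {T : Ty} → Val Γ T → ClosedVal T
  | _, .var v => ρ _ v
  | _, .real r => .real r
  | _, .unit => .unit
  | _, .pair V W => .pair (V.subst ρ) (W.subst ρ)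

/-! ### Operation and predicate symbols -/

/-- Operation symbols `op : T → U` and predicate symbols `pred : T` with their (partial)
evaluation functions; each `op : T → U` comes with a symbol `op_r : T × U → T`. -/
structure Signature : Type (u + 1) where
  Op : Ty → Ty → Type u
  Pred : Ty → Type u
  rev : ∀ {T U : Ty}, Op T U → Op (.prod T U) T
  ev : ∀ {T U : Ty}, Op T U → ClosedVal T → Part (ClosedVal U)
  bev : ∀ {T : Ty}, Pred T → ClosedVal T → Part Bool

/-! ### Terms and trace terms -/

/-- Well-typed terms and boolean terms.  The body of a recursive function has no free ordinary
variables besides its parameter. -/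
inductive Tm (S : Signature.{u}) : List (Ty × Ty) → List Ty → Srt → Type u
  | var {Φ : List (Ty × Ty)} {Γ : List Ty} {T : Ty} : Var Γ T → Tm S Φ Γ (.ty T)
  | real {Φ : List (Ty × Ty)} {Γ : List Ty} : ℝ → Tm S Φ Γ (.ty .real)
  | add {Φ : List (Ty × Ty)} {Γ : List Ty} :
      Tm S Φ Γ (.ty .real) → Tm S Φ Γ (.ty .real) → Tm S Φ Γ (.ty .real)
  | op {Φ : List (Ty × Ty)} {Γ : List Ty} {T U : Ty} :
      S.Op T U → Tm S Φ Γ (.ty T) → Tm S Φ Γ (.ty U)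
  /-- `let x : T = M in N` -/
  | letin {Φ : List (Ty × Ty)} {Γ : List Ty} {T U : Ty}
      (M : Tm S Φ Γ (.ty T)) (N : Tm S Φ (T :: Γ) (.ty U)) : Tm S Φ Γ (.ty U)
  | unit {Φ : List (Ty × Ty)} {Γ : List Ty} : Tm S Φ Γ (.ty .unit)
  | pair {Φ : List (Ty × Ty)} {Γ : List Ty} {T U : Ty} :
      Tm S Φ Γ (.ty T) → Tm S Φ Γ (.ty U) → Tm S Φ Γ (.ty (.prod T U))
  | fst {Φ : List (Ty × Ty)} {Γ : List Ty} {T U : Ty} :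
      Tm S Φ Γ (.ty (.prod T U)) → Tm S Φ Γ (.ty T)
  | snd {Φ : List (Ty × Ty)} {Γ : List Ty} {T U : Ty} :
      Tm S Φ Γ (.ty (.prod T U)) → Tm S Φ Γ (.ty U)
  | ite {Φ : List (Ty × Ty)} {Γ : List Ty} {T : Ty} (B : Tm S Φ Γ .bool)
      (M N : Tm S Φ Γ (.ty T)) : Tm S Φ Γ (.ty T)
  /-- `letrec f(x : T) : U = M in N` -/
  | letrec {Φ : List (Ty × Ty)} {Γ : List Ty} {T U R : Ty}
      (M : Tm S ((T, U) :: Φ) [T] (.ty U)) (N : Tm S ((T, U) :: Φ) Γ (.ty R)) :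
      Tm S Φ Γ (.ty R)
  /-- `f(M)` -/
  | app {Φ : List (Ty × Ty)} {Γ : List Ty} {T U : Ty}
      (f : Var Φ (T, U)) (M : Tm S Φ Γ (.ty T)) : Tm S Φ Γ (.ty U)
  /-- `rd(x : T. N)(L, M)`: the reverse-mode derivative at `L` of the function `x ↦ N`,
  evaluated at `M` -/
  | rd {Φ : List (Ty × Ty)} {Γ : List Ty} {T U : Ty}
      (N : Tm S Φ (T :: Γ) (.ty U)) (L : Tm S Φ Γ (.ty T)) (M : Tm S Φ Γ (.ty U)) :
      Tm S Φ Γ (.ty T)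
  | pred {Φ : List (Ty × Ty)} {Γ : List Ty} {T : Ty} :
      S.Pred T → Tm S Φ Γ (.ty T) → Tm S Φ Γ .bool
  | tt {Φ : List (Ty × Ty)} {Γ : List Ty} : Tm S Φ Γ .bool
  | ff {Φ : List (Ty × Ty)} {Γ : List Ty} : Tm S Φ Γ .bool

/-- Trace terms: terms without conditionals, function definitions, applications, and
differentiation. -/
inductive Tr (S : Signature.{u}) : List Ty → Ty → Type u
  | var {Γ : List Ty} {T : Ty} : Var Γ T → Tr S Γ T
  | real {Γ : List Ty} : ℝ → Tr S Γ .real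
  | add {Γ : List Ty} : Tr S Γ .real → Tr S Γ .real → Tr S Γ .real
  | op {Γ : List Ty} {T U : Ty} : S.Op T U → Tr S Γ T → Tr S Γ U
  | letin {Γ : List Ty} {T U : Ty} (C : Tr S Γ T) (D : Tr S (T :: Γ) U) : Tr S Γ U
  | unit {Γ : List Ty} : Tr S Γ .unit
  | pair {Γ : List Ty} {T U : Ty} : Tr S Γ T → Tr S Γ U → Tr S Γ (.prod T U)
  | fst {Γ : List Ty} {T U : Ty} : Tr S Γ (.prod T U) → Tr S Γ T
  | snd {Γ : List Ty} {T U : Ty} : Tr S Γ (.prod T U) → Tr S Γ U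

variable {S : Signature.{u}}

def Tm.rename : {Φ : List (Ty × Ty)} → {Γ Δ : List Ty} → {s : Srt} →
    Ren Γ Δ → Tm S Φ Γ s → Tm S Φ Δ s
  | _, _, _, _, θ, .var v => .var (θ _ v)
  | _, _, _, _, _, .real r => .real r
  | _, _, _, _, θ, .add M N => .add (M.rename θ) (N.rename θ)
  | _, _, _, _, θ, .op o M => .op o (M.rename θ)
  | _, _, _, _, θ, .letin M N => .letin (M.rename θ) (N.rename (θ.lift _))
  | _, _, _, _, _, .unit => .unit
  | _, _, _, _, θ, .pair M N => .pair (M.rename θ) (N.rename θ)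
  | _, _, _, _, θ, .fst M => .fst (M.rename θ)
  | _, _, _, _, θ, .snd M => .snd (M.rename θ)
  | _, _, _, _, θ, .ite B M N => .ite (B.rename θ) (M.rename θ) (N.rename θ)
  | _, _, _, _, θ, .letrec M N => .letrec M (N.rename θ)
  | _, _, _, _, θ, .app f M => .app f (M.rename θ)
  | _, _, _, _, θ, .rd N L M => .rd (N.rename (θ.lift _)) (L.rename θ) (M.rename θ)
  | _, _, _, _, θ, .pred p M => .pred p (M.rename θ)
  | _, _, _, _, _, .tt => .tt
  | _, _, _, _, _, .ff => .ff

def Tr.rename : {Γ Δ : List Ty} → {T : Ty} → Ren Γ Δ → Tr S Γ T → Tr S Δ T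
  | _, _, _, θ, .var v => .var (θ _ v)
  | _, _, _, _, .real r => .real r
  | _, _, _, θ, .add C D => .add (C.rename θ) (D.rename θ)
  | _, _, _, θ, .op o C => .op o (C.rename θ)
  | _, _, _, θ, .letin C D => .letin (C.rename θ) (D.rename (θ.lift _))
  | _, _, _, _, .unit => .unit
  | _, _, _, θ, .pair C D => .pair (C.rename θ) (D.rename θ)
  | _, _, _, θ, .fst C => .fst (C.rename θ)
  | _, _, _, θ, .snd C => .snd (C.rename θ)

/-- Values are trace terms. -/
def Val.toTr {Γ : List Ty} : {T : Ty} → Val Γ T → Tr S Γ T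
  | _, .var v => .var v
  | _, .real r => .real r
  | _, .unit => .unit
  | _, .pair V W => .pair V.toTr W.toTr

/-- Trace terms are terms. -/
def Tr.toTm {Φ : List (Ty × Ty)} : {Γ : List Ty} → {T : Ty} → Tr S Γ T → Tm S Φ Γ (.ty T)
  | _, _, .var v => .var v
  | _, _, .real r => .real r
  | _, _, .add C D => .add C.toTm D.toTm
  | _, _, .op o C => .op o C.toTm
  | _, _, .letin C D => .letin C.toTm D.toTm
  | _, _, .unit => .unit
  | _, _, .pair C D => .pair C.toTm D.toTm
  | _, _, .fst C => .fst C.toTm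
  | _, _, .snd C => .snd C.toTm

/-- Values are terms. -/
def Val.toTm {Φ : List (Ty × Ty)} {Γ : List Ty} {T : Ty} (V : Val Γ T) : Tm S Φ Γ (.ty T) :=
  V.toTr.toTm

/-- Boolean values are boolean terms. -/
def Tm.ofBool {Φ : List (Ty × Ty)} {Γ : List Ty} : Bool → Tm S Φ Γ .bool
  | true => .tt
  | false => .ff

/-! ### Symbolic differentiation of trace terms -/

/-- `let ⟨x : T, y : U⟩ = C in D`, that is
`let z : T × U = C in let x : T = fst(z) in let y : U = snd(z) in D`. -/
def Tr.letPair {Γ : List Ty} {T U R : Ty} (C : Tr S Γ (.prod T U))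
    (D : Tr S (U :: T :: .prod T U :: Γ) R) : Tr S Γ R :=
  .letin C (.letin (.fst (.var .z)) (.letin (.snd (.var (.s .z))) D))

/-- `C +_T D`. -/
def Tr.addT : (T : Ty) → {Γ : List Ty} → Tr S Γ T → Tr S Γ T → Tr S Γ T
  | .real, _, C, D => .add C D
  | .unit, _, C, D => .letin C (.letin (D.rename (wk1 _)) .unit)
  | .prod T U, _, C, D =>
      .letPair C (.letPair (D.rename (wk3 _ _ _))
        (.pair
          (Tr.addT T (.var (.s (.s (.s (.s .z))))) (.var (.s .z)))
          (Tr.addT U (.var (.s (.s (.s .z)))) (.var .z))))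

/-- Auxiliary function for `Tr.sdiff`.  The trace term to be differentiated is `C` with its
variables renamed along `θ`; in the target environment `T :: Γ` of `θ`, the head is the
differentiation variable `x : T`, and the variables in `Γ` are the other ones. -/
def Tr.sdiffAux : {Δ : List Ty} → {U : Ty} → Tr S Δ U →
    {Γ : List Ty} → {T : Ty} → Ren Δ (T :: Γ) → Val Γ T → Val Γ U → Tr S Γ T
  | _, U, .var v, Γ, _, θ, _, W =>
      let go : {T' U' : Ty} → Var (T' :: Γ) U' → Val Γ U' → Tr S Γ T' := fun
        | .z, W' => W'.toTr
        | .s _, _ => (Val.zero _).toTr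
      go (θ U v) W
  | _, _, .real _, _, T, _, _, _ => (Val.zero T).toTr
  | _, _, .add D E, _, T, θ, V, W => Tr.addT T (D.sdiffAux θ V W) (E.sdiffAux θ V W)
  -- `let x = V in let y = op_r⟨D, W⟩ in y.R_V(x. D)`
  | _, _, .op (T := A) o D, _, T, θ, V, W =>
      .letin V.toTr
        (.letin (.op (S.rev o) (.pair (D.rename θ) (W.rename (wk1 T)).toTr))
          (D.sdiffAux (fun _ v => (wk2 T A).lift T _ (θ _ v)) (V.rename (wk2 T A)) (.var .z)))
  -- `let x = V in let y = D in W.R_V(x. E) +_T (let y' = W.R_y(y. E) in y'.R_V(x. D))`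
  | _, _, .letin (T := A) D E, _, T, θ, V, W =>
      .letin V.toTr
        (.letin (D.rename θ)
          (Tr.addT T
            (E.sdiffAux
              (fun
                | _, .z => .s .z
                | _, .s v => (wk2 T A).lift T _ (θ _ v))
              (V.rename (wk2 T A)) (W.rename (wk2 T A)))
            (.letin
              (E.sdiffAux
                (fun _ v => (wk1 A).lift A _ (θ.lift A _ v))
                (.var .z) (W.rename (wk2 T A)))
              (D.sdiffAux
                (fun _ v => (wk3 T A A).lift T _ (θ _ v))
                (V.rename (wk3 T A A)) (.var .z)))))
  | _, _, .unit, _, T, _, _, _ => (Val.zero T).toTr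
  -- `let ⟨y, z⟩ = W in y.R_V(x. D) +_T z.R_V(x. E)`
  | _, _, .pair (T := A) (U := B) D E, _, T, θ, V, W =>
      .letPair W.toTr
        (Tr.addT T
          (D.sdiffAux (fun _ v => (wk3 (.prod A B) A B).lift T _ (θ _ v))
            (V.rename (wk3 (.prod A B) A B)) (.var (.s .z)))
          (E.sdiffAux (fun _ v => (wk3 (.prod A B) A B).lift T _ (θ _ v))
            (V.rename (wk3 (.prod A B) A B)) (.var .z)))
  -- `let x = V in let y = D in ⟨W, 0⟩.R_V(x. D)`
  | _, _, .fst (T := A) (U := B) D, _, T, θ, V, W =>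
      .letin V.toTr
        (.letin (D.rename θ)
          (D.sdiffAux (fun _ v => (wk2 T (.prod A B)).lift T _ (θ _ v))
            (V.rename (wk2 T (.prod A B)))
            (.pair (W.rename (wk2 T (.prod A B))) (Val.zero B))))
  -- `let x = V in let y = D in ⟨0, W⟩.R_V(x. D)`
  | _, _, .snd (T := A) (U := B) D, _, T, θ, V, W =>
      .letin V.toTr
        (.letin (D.rename θ)
          (D.sdiffAux (fun _ v => (wk2 T (.prod A B)).lift T _ (θ _ v))
            (V.rename (wk2 T (.prod A B)))
            (.pair (Val.zero A) (W.rename (wk2 T (.prod A B))))))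

/-- `W.R_V(x : T. C)`: the symbolic reverse-mode derivative of `C` with respect to the variable
`x : T` at `V`, evaluated at `W`. -/
def Tr.sdiff {Γ : List Ty} {T U : Ty} (C : Tr S (T :: Γ) U) (V : Val Γ T) (W : Val Γ U) :
    Tr S Γ T :=
  C.sdiffAux (fun _ v => v) V W

/-! ### Closures and function environments -/

/-- Recursive function closures `⟨φ, f(x : T) : U. M⟩` of type `T → U`, where the function
environment `φ` assigns a closure of the right type to every function variable. -/
inductive Clo (S : Signature.{u}) : Ty → Ty → Type u
  | mk {Φ : List (Ty × Ty)} {T U : Ty} (φ : ∀ T' U' : Ty, Var Φ (T', U') → Clo S T' U')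
      (M : Tm S ((T, U) :: Φ) [T] (.ty U)) : Clo S T U

/-- Function environments `φ : Φ`. -/
abbrev FEnv (S : Signature.{u}) (Φ : List (Ty × Ty)) : Type u :=
  ∀ T U : Ty, Var Φ (T, U) → Clo S T U

/-- The function environment `φ[Cl/f]`. -/
def FEnv.cons {Φ : List (Ty × Ty)} {T U : Ty} (c : Clo S T U) (φ : FEnv S Φ) :
    FEnv S ((T, U) :: Φ)
  | _, _, .z => c
  | _, _, .s f => φ _ _ f

/-! ### Evaluation contexts and redexes -/

/-- `ECtx S Φ Γ h s`: evaluation contexts of sort `s` with a unique hole of sort `h`.  The contexts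
with `s = .bool` are the boolean evaluation contexts.  The hole never lies under a binder. -/
inductive ECtx (S : Signature.{u}) (Φ : List (Ty × Ty)) (Γ : List Ty) : Srt → Srt → Type u
  | hole {h : Srt} : ECtx S Φ Γ h h
  | addL {h : Srt} : ECtx S Φ Γ h (.ty .real) → Tm S Φ Γ (.ty .real) → ECtx S Φ Γ h (.ty .real)
  | addR {h : Srt} : Val Γ .real → ECtx S Φ Γ h (.ty .real) → ECtx S Φ Γ h (.ty .real)
  | op {h : Srt} {T U : Ty} : S.Op T U → ECtx S Φ Γ h (.ty T) → ECtx S Φ Γ h (.ty U)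
  | letin {h : Srt} {T U : Ty} :
      ECtx S Φ Γ h (.ty T) → Tm S Φ (T :: Γ) (.ty U) → ECtx S Φ Γ h (.ty U)
  | pairL {h : Srt} {T U : Ty} :
      ECtx S Φ Γ h (.ty T) → Tm S Φ Γ (.ty U) → ECtx S Φ Γ h (.ty (.prod T U))
  | pairR {h : Srt} {T U : Ty} :
      Val Γ T → ECtx S Φ Γ h (.ty U) → ECtx S Φ Γ h (.ty (.prod T U))
  | fst {h : Srt} {T U : Ty} : ECtx S Φ Γ h (.ty (.prod T U)) → ECtx S Φ Γ h (.ty T)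
  | snd {h : Srt} {T U : Ty} : ECtx S Φ Γ h (.ty (.prod T U)) → ECtx S Φ Γ h (.ty U)
  | ite {h : Srt} {T : Ty} :
      ECtx S Φ Γ h .bool → Tm S Φ Γ (.ty T) → Tm S Φ Γ (.ty T) → ECtx S Φ Γ h (.ty T)
  | app {h : Srt} {T U : Ty} : Var Φ (T, U) → ECtx S Φ Γ h (.ty T) → ECtx S Φ Γ h (.ty U)
  | rdL {h : Srt} {T U : Ty} : Tm S Φ (T :: Γ) (.ty U) → ECtx S Φ Γ h (.ty T) →
      Tm S Φ Γ (.ty U) → ECtx S Φ Γ h (.ty T)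
  | rdR {h : Srt} {T U : Ty} : Tm S Φ (T :: Γ) (.ty U) → Val Γ T →
      ECtx S Φ Γ h (.ty U) → ECtx S Φ Γ h (.ty T)
  | pred {h : Srt} {T : Ty} : S.Pred T → ECtx S Φ Γ h (.ty T) → ECtx S Φ Γ h .bool

/-- A context is nontrivial if it is not just a hole. -/
def ECtx.Nontrivial {Φ : List (Ty × Ty)} {Γ : List Ty} {h s : Srt} : ECtx S Φ Γ h s → Prop
  | .hole => False
  | _ => True

/-- `E[M]`. -/
def ECtx.plug {Φ : List (Ty × Ty)} {Γ : List Ty} {h : Srt} :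
    {s : Srt} → ECtx S Φ Γ h s → Tm S Φ Γ h → Tm S Φ Γ s
  | _, .hole, P => P
  | _, .addL E N, P => .add (E.plug P) N
  | _, .addR V E, P => .add V.toTm (E.plug P)
  | _, .op o E, P => .op o (E.plug P)
  | _, .letin E N, P => .letin (E.plug P) N
  | _, .pairL E N, P => .pair (E.plug P) N
  | _, .pairR V E, P => .pair V.toTm (E.plug P)
  | _, .fst E, P => .fst (E.plug P)
  | _, .snd E, P => .snd (E.plug P)
  | _, .ite E M N, P => .ite (E.plug P) M N
  | _, .app f E, P => .app f (E.plug P)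
  | _, .rdL N E M, P => .rd N (E.plug P) M
  | _, .rdR N V E, P => .rd N V.toTm (E.plug P)
  | _, .pred p E, P => .pred p (E.plug P)

def ECtx.rename {Φ : List (Ty × Ty)} {Γ Δ : List Ty} {h : Srt} (θ : Ren Γ Δ) :
    {s : Srt} → ECtx S Φ Γ h s → ECtx S Φ Δ h s
  | _, .hole => .hole
  | _, .addL E N => .addL (E.rename θ) (N.rename θ)
  | _, .addR V E => .addR (V.rename θ) (E.rename θ)
  | _, .op o E => .op o (E.rename θ)
  | _, .letin E N => .letin (E.rename θ) (N.rename (θ.lift _))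
  | _, .pairL E N => .pairL (E.rename θ) (N.rename θ)
  | _, .pairR V E => .pairR (V.rename θ) (E.rename θ)
  | _, .fst E => .fst (E.rename θ)
  | _, .snd E => .snd (E.rename θ)
  | _, .ite E M N => .ite (E.rename θ) (M.rename θ) (N.rename θ)
  | _, .app f E => .app f (E.rename θ)
  | _, .rdL N E M => .rdL (N.rename (θ.lift _)) (E.rename θ) (M.rename θ)
  | _, .rdR N V E => .rdR (N.rename (θ.lift _)) (V.rename θ) (E.rename θ)
  | _, .pred p E => .pred p (E.rename θ)

/-- `E[x]`, for a fresh variable `x : T`. -/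
def ECtx.plugVar {Φ : List (Ty × Ty)} {Γ : List Ty} {T : Ty} {s : Srt}
    (E : ECtx S Φ Γ (.ty T) s) : Tm S Φ (T :: Γ) s :=
  (E.rename (wk1 T)).plug (.var .z)

/-- Redexes (of sort `.ty T`) and boolean redexes (of sort `.bool`). -/
inductive Redex {Φ : List (Ty × Ty)} {Γ : List Ty} : {s : Srt} → Tm S Φ Γ s → Prop
  | add (V W : Val Γ .real) : Redex (.add V.toTm W.toTm)
  | op {T U : Ty} (o : S.Op T U) (V : Val Γ T) : Redex (.op o V.toTm)
  | letin {T U : Ty} (V : Val Γ T) (N : Tm S Φ (T :: Γ) (.ty U)) : Redex (.letin V.toTm N)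
  | fst {T U : Ty} (V : Val Γ (.prod T U)) : Redex (.fst V.toTm)
  | snd {T U : Ty} (V : Val Γ (.prod T U)) : Redex (.snd V.toTm)
  | ite {T : Ty} (b : Bool) (M N : Tm S Φ Γ (.ty T)) : Redex (.ite (.ofBool b) M N)
  | letrec {T U R : Ty} (M : Tm S ((T, U) :: Φ) [T] (.ty U))
      (N : Tm S ((T, U) :: Φ) Γ (.ty R)) : Redex (.letrec M N)
  | app {T U : Ty} (f : Var Φ (T, U)) (V : Val Γ T) : Redex (.app f V.toTm)
  | rd {T U : Ty} (N : Tm S Φ (T :: Γ) (.ty U)) (V : Val Γ T) (W : Val Γ U) :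
      Redex (.rd N V.toTm W.toTm)
  | pred {T : Ty} (p : S.Pred T) (V : Val Γ T) : Redex (.pred p V.toTm)

/-! ### Operational semantics -/

mutual

/-- Ordinary evaluation `φ | ρ ⊢ M ⇒ V` and `φ | ρ ⊢ B ⇒ V_bool`. -/
inductive Eval (S : Signature.{u}) : {Φ : List (Ty × Ty)} → {Γ : List Ty} → {s : Srt} →
    FEnv S Φ → VEnv Γ → Tm S Φ Γ s → s.Value → Prop
  | val {Φ : List (Ty × Ty)} {Γ : List Ty} {φ : FEnv S Φ} {ρ : VEnv Γ} {T : Ty} (V : Val Γ T) :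
      Eval S (s := .ty T) φ ρ V.toTm (V.subst ρ)
  | bval {Φ : List (Ty × Ty)} {Γ : List Ty} {φ : FEnv S Φ} {ρ : VEnv Γ} (b : Bool) :
      Eval S (s := .bool) φ ρ (.ofBool b) b
  | add {Φ : List (Ty × Ty)} {Γ : List Ty} {φ : FEnv S Φ} {ρ : VEnv Γ}
      {V W : Val Γ .real} {a b : ℝ} :
      Eval S (s := .ty .real) φ ρ V.toTm (.real a) →
      Eval S (s := .ty .real) φ ρ W.toTm (.real b) →
      Eval S (s := .ty .real) φ ρ (.add V.toTm W.toTm) (.real (a + b))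
  | op {Φ : List (Ty × Ty)} {Γ : List Ty} {φ : FEnv S Φ} {ρ : VEnv Γ} {T U : Ty}
      {o : S.Op T U} {V : Val Γ T} {V' : ClosedVal T} {W : ClosedVal U} :
      Eval S (s := .ty T) φ ρ V.toTm V' → W ∈ S.ev o V' →
      Eval S (s := .ty U) φ ρ (.op o V.toTm) W
  | letin {Φ : List (Ty × Ty)} {Γ : List Ty} {φ : FEnv S Φ} {ρ : VEnv Γ} {T U : Ty}
      {V : Val Γ T} {N : Tm S Φ (T :: Γ) (.ty U)} {V' : ClosedVal T} {W : ClosedVal U} :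
      Eval S (s := .ty T) φ ρ V.toTm V' → Eval S (s := .ty U) φ (ρ.cons V') N W →
      Eval S (s := .ty U) φ ρ (.letin V.toTm N) W
  | fst {Φ : List (Ty × Ty)} {Γ : List Ty} {φ : FEnv S Φ} {ρ : VEnv Γ} {T U : Ty}
      {V : Val Γ (.prod T U)} {W₁ : ClosedVal T} {W₂ : ClosedVal U} :
      Eval S (s := .ty (.prod T U)) φ ρ V.toTm (.pair W₁ W₂) →
      Eval S (s := .ty T) φ ρ (.fst V.toTm) W₁
  | snd {Φ : List (Ty × Ty)} {Γ : List Ty} {φ : FEnv S Φ} {ρ : VEnv Γ} {T U : Ty}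
      {V : Val Γ (.prod T U)} {W₁ : ClosedVal T} {W₂ : ClosedVal U} :
      Eval S (s := .ty (.prod T U)) φ ρ V.toTm (.pair W₁ W₂) →
      Eval S (s := .ty U) φ ρ (.snd V.toTm) W₂
  | iteTrue {Φ : List (Ty × Ty)} {Γ : List Ty} {φ : FEnv S Φ} {ρ : VEnv Γ} {T : Ty}
      {M N : Tm S Φ Γ (.ty T)} {V : ClosedVal T} :
      Eval S (s := .ty T) φ ρ M V → Eval S (s := .ty T) φ ρ (.ite .tt M N) V
  | iteFalse {Φ : List (Ty × Ty)} {Γ : List Ty} {φ : FEnv S Φ} {ρ : VEnv Γ} {T : Ty}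
      {M N : Tm S Φ Γ (.ty T)} {V : ClosedVal T} :
      Eval S (s := .ty T) φ ρ N V → Eval S (s := .ty T) φ ρ (.ite .ff M N) V
  | letrec {Φ : List (Ty × Ty)} {Γ : List Ty} {φ : FEnv S Φ} {ρ : VEnv Γ} {T U R : Ty}
      {M : Tm S ((T, U) :: Φ) [T] (.ty U)} {N : Tm S ((T, U) :: Φ) Γ (.ty R)}
      {V : ClosedVal R} :
      Eval S (s := .ty R) (φ.cons (Clo.mk φ M)) ρ N V →
      Eval S (s := .ty R) φ ρ (.letrec M N) V
  | app {Φ Φ' : List (Ty × Ty)} {Γ : List Ty} {φ : FEnv S Φ} {ρ : VEnv Γ} {T U : Ty}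
      {f : Var Φ (T, U)} {V : Val Γ T} {V' : ClosedVal T} {W : ClosedVal U}
      {φ' : FEnv S Φ'} {M : Tm S ((T, U) :: Φ') [T] (.ty U)} :
      φ T U f = Clo.mk φ' M →
      Eval S (s := .ty T) φ ρ V.toTm V' →
      Eval S (s := .ty U) (φ'.cons (φ T U f)) (VEnv.nil.cons V') M W →
      Eval S (s := .ty U) φ ρ (.app f V.toTm) W
  | rd {Φ : List (Ty × Ty)} {Γ : List Ty} {φ : FEnv S Φ} {ρ : VEnv Γ} {T U : Ty}
      {N : Tm S Φ (T :: Γ) (.ty U)} {V : Val Γ T} {W : Val Γ U} {C : Tr S Γ T}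
      {X : ClosedVal T} :
      SEval S φ ρ (.rd N V.toTm W.toTm) C → Eval S (s := .ty T) φ ρ C.toTm X →
      Eval S (s := .ty T) φ ρ (.rd N V.toTm W.toTm) X
  | pred {Φ : List (Ty × Ty)} {Γ : List Ty} {φ : FEnv S Φ} {ρ : VEnv Γ} {T : Ty}
      {p : S.Pred T} {V : Val Γ T} {V' : ClosedVal T} {b : Bool} :
      Eval S (s := .ty T) φ ρ V.toTm V' → b ∈ S.bev p V' →
      Eval S (s := .bool) φ ρ (.pred p V.toTm) b
  /-- `E[R]` and `E_bool[R]` for a redex `R` -/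
  | ctx {Φ : List (Ty × Ty)} {Γ : List Ty} {φ : FEnv S Φ} {ρ : VEnv Γ} {T : Ty} {s : Srt}
      {E : ECtx S Φ Γ (.ty T) s} {R : Tm S Φ Γ (.ty T)} {V : ClosedVal T} {w : s.Value} :
      E.Nontrivial → Redex R →
      Eval S (s := .ty T) φ ρ R V → Eval S φ (ρ.cons V) E.plugVar w →
      Eval S φ ρ (E.plug R) w
  /-- `E[R_bool]` and `E_bool[R_bool]` for a boolean redex `R_bool` -/
  | bctx {Φ : List (Ty × Ty)} {Γ : List Ty} {φ : FEnv S Φ} {ρ : VEnv Γ} {s : Srt}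
      {E : ECtx S Φ Γ .bool s} {R : Tm S Φ Γ .bool} {b : Bool} {w : s.Value} :
      Redex R →
      Eval S (s := .bool) φ ρ R b → Eval S φ ρ (E.plug (.ofBool b)) w →
      Eval S φ ρ (E.plug R) w

/-- Symbolic evaluation `φ | ρ ⊢ M ⇝ C`. -/
inductive SEval (S : Signature.{u}) : {Φ : List (Ty × Ty)} → {Γ : List Ty} → {T : Ty} →
    FEnv S Φ → VEnv Γ → Tm S Φ Γ (.ty T) → Tr S Γ T → Prop
  | val {Φ : List (Ty × Ty)} {Γ : List Ty} {φ : FEnv S Φ} {ρ : VEnv Γ} {T : Ty} (V : Val Γ T) :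
      SEval S φ ρ V.toTm V.toTr
  | add {Φ : List (Ty × Ty)} {Γ : List Ty} {φ : FEnv S Φ} {ρ : VEnv Γ} (V W : Val Γ .real) :
      SEval S φ ρ (.add V.toTm W.toTm) (.add V.toTr W.toTr)
  | op {Φ : List (Ty × Ty)} {Γ : List Ty} {φ : FEnv S Φ} {ρ : VEnv Γ} {T U : Ty}
      (o : S.Op T U) (V : Val Γ T) : SEval S φ ρ (.op o V.toTm) (.op o V.toTr)
  | letin {Φ : List (Ty × Ty)} {Γ : List Ty} {φ : FEnv S Φ} {ρ : VEnv Γ} {T U : Ty}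
      {V : Val Γ T} {N : Tm S Φ (T :: Γ) (.ty U)} {V' : ClosedVal T} {C : Tr S (T :: Γ) U} :
      Eval S (s := .ty T) φ ρ V.toTm V' → SEval S φ (ρ.cons V') N C →
      SEval S φ ρ (.letin V.toTm N) (.letin V.toTr C)
  | fst {Φ : List (Ty × Ty)} {Γ : List Ty} {φ : FEnv S Φ} {ρ : VEnv Γ} {T U : Ty}
      (V : Val Γ (.prod T U)) : SEval S φ ρ (.fst V.toTm) (.fst V.toTr)
  | snd {Φ : List (Ty × Ty)} {Γ : List Ty} {φ : FEnv S Φ} {ρ : VEnv Γ} {T U : Ty}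
      (V : Val Γ (.prod T U)) : SEval S φ ρ (.snd V.toTm) (.snd V.toTr)
  | iteTrue {Φ : List (Ty × Ty)} {Γ : List Ty} {φ : FEnv S Φ} {ρ : VEnv Γ} {T : Ty}
      {M N : Tm S Φ Γ (.ty T)} {C : Tr S Γ T} :
      SEval S φ ρ M C → SEval S φ ρ (.ite .tt M N) C
  | iteFalse {Φ : List (Ty × Ty)} {Γ : List Ty} {φ : FEnv S Φ} {ρ : VEnv Γ} {T : Ty}
      {M N : Tm S Φ Γ (.ty T)} {C : Tr S Γ T} :
      SEval S φ ρ N C → SEval S φ ρ (.ite .ff M N) C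
  | letrec {Φ : List (Ty × Ty)} {Γ : List Ty} {φ : FEnv S Φ} {ρ : VEnv Γ} {T U R : Ty}
      {M : Tm S ((T, U) :: Φ) [T] (.ty U)} {N : Tm S ((T, U) :: Φ) Γ (.ty R)}
      {C : Tr S Γ R} :
      SEval S (φ.cons (Clo.mk φ M)) ρ N C → SEval S φ ρ (.letrec M N) C
  | app {Φ Φ' : List (Ty × Ty)} {Γ : List Ty} {φ : FEnv S Φ} {ρ : VEnv Γ} {T U : Ty}
      {f : Var Φ (T, U)} {V : Val Γ T} {V' : ClosedVal T}
      {φ' : FEnv S Φ'} {M : Tm S ((T, U) :: Φ') [T] (.ty U)} {C : Tr S [T] U} :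
      φ T U f = Clo.mk φ' M →
      Eval S (s := .ty T) φ ρ V.toTm V' →
      SEval S (φ'.cons (φ T U f)) (VEnv.nil.cons V') M C →
      SEval S φ ρ (.app f V.toTm) (.letin V.toTr (C.rename (Ren.nil.lift T)))
  | rd {Φ : List (Ty × Ty)} {Γ : List Ty} {φ : FEnv S Φ} {ρ : VEnv Γ} {T U : Ty}
      {N : Tm S Φ (T :: Γ) (.ty U)} {V : Val Γ T} {W : Val Γ U} {V' : ClosedVal T}
      {C : Tr S (T :: Γ) U} :
      Eval S (s := .ty T) φ ρ V.toTm V' → SEval S φ (ρ.cons V') N C →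
      SEval S φ ρ (.rd N V.toTm W.toTm) (C.sdiff V W)
  | ctx {Φ : List (Ty × Ty)} {Γ : List Ty} {φ : FEnv S Φ} {ρ : VEnv Γ} {T U : Ty}
      {E : ECtx S Φ Γ (.ty T) (.ty U)} {R : Tm S Φ Γ (.ty T)} {C : Tr S Γ T}
      {V : ClosedVal T} {D : Tr S (T :: Γ) U} :
      E.Nontrivial → Redex R →
      SEval S φ ρ R C → Eval S (s := .ty T) φ ρ C.toTm V → SEval S φ (ρ.cons V) E.plugVar D →
      SEval S φ ρ (E.plug R) (.letin C D)
  | bctx {Φ : List (Ty × Ty)} {Γ : List Ty} {φ : FEnv S Φ} {ρ : VEnv Γ} {U : Ty}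
      {E : ECtx S Φ Γ .bool (.ty U)} {R : Tm S Φ Γ .bool} {b : Bool} {C : Tr S Γ U} :
      Redex R →
      Eval S (s := .bool) φ ρ R b → SEval S φ ρ (E.plug (.ofBool b)) C →
      SEval S φ ρ (E.plug R) C

end

/-! ### Partial functions between powers of the reals -/

/-- The real vector space `ℝⁿ`. -/
abbrev RV (n : ℕ) : Type := Fin n → ℝ

/-- Partial functions from `ℝⁿ` to `ℝᵐ`, ordered pointwise, i.e. by inclusion of graphs. -/
abbrev PF (n m : ℕ) : Type := RV n → Part (RV m)

/-- The domain of a partial function. -/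
def PF.dom {n m : ℕ} (f : PF n m) : Set (RV n) := {x | (f x).Dom}

open Classical in
/-- The extension of a partial function by `0`. -/
def PF.total {n m : ℕ} (f : PF n m) (x : RV n) : RV m := (f x).getOrElse 0

/-- Smooth partial functions: the domain is open and the function is `C^∞` there. -/
def PF.Smooth {n m : ℕ} (f : PF n m) : Prop :=
  IsOpen f.dom ∧ ContDiffOn ℝ ∞ f.total f.dom

/-- The reverse-mode derivative `dʳ(f)(x, y) = J_x(f)ᵗ · y`.  It is defined iff `f` is defined
around `x` and all partial derivatives `∂_j f_i` exist at `x`. -/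
def PF.revDeriv {n m : ℕ} (f : PF n m) (x : RV n) (y : RV m) : Part (RV n) where
  Dom := (∀ᶠ z in 𝓝 x, z ∈ f.dom) ∧
    ∀ (i : Fin m) (j : Fin n),
      LineDifferentiableAt ℝ (fun z => f.total z i) x (Pi.single j 1)
  get _ := fun j => ∑ i : Fin m, lineDeriv ℝ (fun z => f.total z i) x (Pi.single j 1) * y i

open Classical in
/-- `μ α. F(α)`: the least smooth fixed point of `F`.  (It exists for all the functionals that
arise as the denotation of a recursive definition; the value in other cases is irrelevant.) -/
def mu {n m : ℕ} (F : PF n m → PF n m) : PF n m :=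
  if h : ∃ f, IsLeast {f : PF n m | f.Smooth ∧ F f = f} f then h.choose else ⊥

/-! ### Denotational semantics -/

/-- The number `|T|`, with `⟦T⟧ = ℝ^|T|`. -/
def Ty.dim : Ty → ℕ
  | .real => 1
  | .unit => 0
  | .prod T U => T.dim + U.dim

/-- `⟦T⟧`. -/
abbrev Ty.Den (T : Ty) : Type := RV T.dim

/-- `⟦T⟧`, resp. the set of truth values. -/
abbrev Srt.Den : Srt → Type
  | .ty T => T.Den
  | .bool => Bool

/-- The vector `⟨a, b⟩`, and the projections. -/
def vpair {T U : Ty} (a : T.Den) (b : U.Den) : (Ty.prod T U).Den := Fin.append a b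
def vfst {T U : Ty} (c : (Ty.prod T U).Den) : T.Den := fun i => c (Fin.castAdd U.dim i)
def vsnd {T U : Ty} (c : (Ty.prod T U).Den) : U.Den := fun i => c (Fin.natAdd T.dim i)

/-- A real number as an element of `⟦real⟧ = ℝ¹`, and the unique element of `⟦unit⟧ = ℝ⁰`. -/
def vreal (r : ℝ) : Ty.real.Den := fun _ => r
def vstar : Ty.unit.Den := fun i => i.elim0

/-- Semantic environments `γ ∈ ⟦Γ⟧`. -/
abbrev DEnv (Γ : List Ty) : Type := ∀ T : Ty, Var Γ T → T.Den

/-- `γ[a/x]`. -/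
def DEnv.cons {Γ : List Ty} {T : Ty} (a : T.Den) (γ : DEnv Γ) : DEnv (T :: Γ)
  | _, .z => a
  | _, .s v => γ _ v

/-- The empty semantic environment. -/
def DEnv.nil : DEnv [] := fun _ v => nomatch v

/-- Semantic function environments. -/
abbrev DFEnv (Φ : List (Ty × Ty)) : Type := ∀ T U : Ty, Var Φ (T, U) → PF T.dim U.dim

/-- `φ[α/f]`. -/
def DFEnv.cons {Φ : List (Ty × Ty)} {T U : Ty} (α : PF T.dim U.dim) (φ : DFEnv Φ) :
    DFEnv ((T, U) :: Φ)
  | _, _, .z => α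
  | _, _, .s f => φ _ _ f

/-- The denotation of a value. -/
def Val.den {Γ : List Ty} (γ : DEnv Γ) : {T : Ty} → Val Γ T → T.Den
  | _, .var v => γ _ v
  | _, .real r => vreal r
  | _, .unit => vstar
  | _, .pair V W => vpair (V.den γ) (W.den γ)

/-- The denotation of a closed value. -/
def Val.cden {T : Ty} (V : ClosedVal T) : T.Den := V.den DEnv.nil

/-- Interpretations of a signature: operation symbols denote smooth partial functions and predicate
symbols denote continuous ones, in agreement with the evaluation functions; and `op_r` denotes the
reverse-mode derivative of the denotation of `op`. -/
structure Interp (S : Signature.{u}) where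
  op : ∀ {T U : Ty}, S.Op T U → PF T.dim U.dim
  pred : ∀ {T : Ty}, S.Pred T → (T.Den →. Bool)
  op_smooth : ∀ {T U : Ty} (o : S.Op T U), (op o).Smooth
  pred_continuous : ∀ {T : Ty} (p : S.Pred T), PContinuous (pred p)
  op_ev : ∀ {T U : Ty} (o : S.Op T U) (V : ClosedVal T), op o V.cden = (S.ev o V).map Val.cden
  pred_bev : ∀ {T : Ty} (p : S.Pred T) (V : ClosedVal T), pred p V.cden = S.bev p V
  op_rev : ∀ {T U : Ty} (o : S.Op T U) (x : T.Den) (y : U.Den),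
    op (S.rev o) (vpair x y) = (op o).revDeriv x y

/-- The denotation of a term or boolean term. -/
def Tm.den (I : Interp S) : {Φ : List (Ty × Ty)} → {Γ : List Ty} → {s : Srt} →
    Tm S Φ Γ s → DFEnv Φ → DEnv Γ → Part s.Den
  | _, _, _, .var v, _, γ => Part.some (γ _ v)
  | _, _, _, .real r, _, _ => Part.some (vreal r)
  | _, _, _, .add M N, φ, γ =>
      (M.den I φ γ).bind fun a => (N.den I φ γ).bind fun b => Part.some (a + b : RV 1)
  | _, _, _, .op o M, φ, γ => (M.den I φ γ).bind fun a => I.op o a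
  | _, _, _, .letin M N, φ, γ => (M.den I φ γ).bind fun a => N.den I φ (DEnv.cons a γ)
  | _, _, _, .unit, _, _ => Part.some vstar
  | _, _, _, .pair M N, φ, γ =>
      (M.den I φ γ).bind fun a => (N.den I φ γ).bind fun b => Part.some (vpair a b)
  | _, _, _, .fst M, φ, γ => (M.den I φ γ).map vfst
  | _, _, _, .snd M, φ, γ => (M.den I φ γ).map vsnd
  | _, _, _, .ite B M N, φ, γ =>
      (B.den I φ γ).bind fun
        | true => M.den I φ γ
        | false => N.den I φ γ
  | _, _, _, .letrec M N, φ, γ =>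
      N.den I (DFEnv.cons (mu fun α a => M.den I (DFEnv.cons α φ) (DEnv.cons a DEnv.nil)) φ) γ
  | _, _, _, .app f M, φ, γ => (M.den I φ γ).bind fun a => φ _ _ f a
  | _, _, _, .rd N L M, φ, γ =>
      (L.den I φ γ).bind fun x => (M.den I φ γ).bind fun y =>
        PF.revDeriv (fun a => N.den I φ (DEnv.cons a γ)) x y
  | _, _, _, .pred p M, φ, γ => (M.den I φ γ).bind fun a => I.pred p a
  | _, _, _, .tt, _, _ => Part.some true
  | _, _, _, .ff, _, _ => Part.some false

/-- The denotation of a closure: `⟦⟨φ, f(x : T) : U. M⟩⟧ = μ α. λ a. ⟦M⟧(⟦φ⟧[α/f]) a`. -/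
def Clo.den (I : Interp S) : {T U : Ty} → Clo S T U → PF T.dim U.dim
  | _, _, .mk φ M =>
      mu fun α a =>
        M.den I (DFEnv.cons α (fun T' U' f => (φ T' U' f).den I)) (DEnv.cons a DEnv.nil)

/-- The denotation of a function environment. -/
def FEnv.den (I : Interp S) {Φ : List (Ty × Ty)} (φ : FEnv S Φ) : DFEnv Φ :=
  fun T U f => (φ T U f).den I

/-- The denotation of a value environment. -/
def VEnv.den {Γ : List Ty} (ρ : VEnv Γ) : DEnv Γ := fun T v => (ρ T v).cden

end

end DiffLang

/-!
A term whose denotation is defined evaluates, both ordinarily and symbolically.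

Induction on terms alone fails at an application `f(V)`, whose evaluation continues with the body
of a closure. This is where least fixed points enter. The functional of a recursive definition
preserves smoothness and suprema of chains (`Tm.den_smooth`, `Tm.den_isChainSup`), so that `mu` is
the supremum of the Kleene iterates of `⊥` (`SmoothContinuous.isChainSup_mu`). Smoothness is
essential for the continuity of the differentiation construct: as domains are open, the germ of a
supremum at a point of its domain is already the germ of an iterate, and the derivative depends
only on the germ (`IsChainSup.revDeriv`).

The proof is a logical relation `Approximates` between closures and partial functions: a closure is
related to `f` if its body evaluates wherever `f` is defined, with result `f`, and has a trace
that agrees with `f` in a neighbourhood. The relation holds for `⊥`, passes from each Kleene iterate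
to the next, and therefore holds for the least fixed point (`Approximates.mu`). The fundamental
property `adequate_of_approximates` says that terms evaluate under related environments; it is
proved by induction on the size of the term, along the decomposition `E[R]` of terms that are not
values (`Tm.decomposed`): both `R` and `E[x]` are smaller than `E[R]`, except that `R` may be all of
`E[R]`, in which case its immediate subterms are smaller.

At `rd(x. N)(V, W)` the trace of `N` denotes the same function as `N` near the point of
differentiation. By the correctness of symbolic differentiation (`Tr.sdiffCorrect`, the chain rule
in adjoint form) the resulting trace term denotes the derivative. That trace term is not smaller
than the given term, but trace terms contain no recursion, so that they evaluate by a separate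
induction on size (`evaluates_of_weight_eq_zero`).
-/

namespace DiffLang

noncomputable section

variable {S : Signature.{u}}

/-! ### Smooth germs of partial functions -/

theorem exists_some_of_dom {α : Type*} {p : Part α} (h : p.Dom) : ∃ a, p = Part.some a :=
  ⟨p.get h, (Part.some_get h).symm⟩

theorem exists_of_bind_dom {α β : Type*} {p : Part α} {f : α → Part β}
    (h : (p.bind f).Dom) : ∃ a, p = Part.some a ∧ (f a).Dom := by
  obtain ⟨h₁, h₂⟩ := h
  exact ⟨p.get h₁, (Part.some_get h₁).symm, h₂⟩

theorem PF.eq_some_total {n m : ℕ} {f : PF n m} {x : RV n} (h : x ∈ f.dom) :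
    f x = Part.some (f.total x) := by
  classical
  rw [PF.total, Part.getOrElse_of_dom _ h]
  exact (Part.some_get _).symm

theorem PF.total_eq {n m : ℕ} {f : PF n m} {x : RV n} {y : RV m} (h : f x = Part.some y) :
    f.total x = y := by
  classical
  simp only [PF.total, h, Part.getOrElse_some]

/-- Smoothness of a partial function is a local property: it says that near every point of its
domain the function is a total function, smooth at that point. -/
theorem PF.smooth_iff {n m : ℕ} {f : PF n m} :
    f.Smooth ↔ ∀ x, (f x).Dom →
      ∃ h : RV n → RV m, ContDiffAt ℝ ∞ h x ∧ ∀ᶠ z in 𝓝 x, f z = Part.some (h z) := by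
  constructor
  · rintro ⟨ho, hs⟩ x hx
    have hn : f.dom ∈ 𝓝 x := ho.mem_nhds hx
    exact ⟨f.total, (hs x hx).contDiffAt hn, by
      filter_upwards [hn] with z hz using PF.eq_some_total hz⟩
  · intro H
    refine ⟨isOpen_iff_mem_nhds.2 fun x hx => ?_, fun x hx => ?_⟩
    · obtain ⟨h, -, he⟩ := H x hx
      filter_upwards [he] with z hz
      simp [PF.dom, hz]
    · obtain ⟨h, hh, he⟩ := H x hx
      refine (hh.congr_of_eventuallyEq ?_).contDiffWithinAt
      filter_upwards [he] with z hz using PF.total_eq hz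

theorem PF.smooth_bot {n m : ℕ} : (⊥ : PF n m).Smooth :=
  PF.smooth_iff.2 fun _ h => False.elim h

theorem mu_smooth {n m : ℕ} (F : PF n m → PF n m) : (mu F).Smooth := by
  unfold mu
  split_ifs with h
  · exact h.choose_spec.1.1
  · exact PF.smooth_bot

section
variable {E : Type} [NormedAddCommGroup E] [NormedSpace ℝ E]

/-- A family of semantic environments, parametrized by a normed space, is smooth at a point if all
its components are. -/
def EnvSmoothAt {Γ : List Ty} (g : E → DEnv Γ) (x₀ : E) : Prop :=
  ∀ T (v : Var Γ T), ContDiffAt ℝ ∞ (fun x => g x T v) x₀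

/-- Near `x₀`, the family `p` of partial elements is a total function that is smooth at `x₀`; for
truth values this means that it is constant near `x₀`. -/
def SmoothGerm : {s : Srt} → (E → Part s.Den) → E → Prop
  | .ty T, p, x₀ => ∃ h : E → T.Den, ContDiffAt ℝ ∞ h x₀ ∧ ∀ᶠ x in 𝓝 x₀, p x = Part.some (h x)
  | .bool, p, x₀ => ∃ b : Bool, ∀ᶠ x in 𝓝 x₀, p x = Part.some b

theorem EnvSmoothAt.cons {Γ : List Ty} {T : Ty} {g : E → DEnv Γ} {h : E → T.Den} {x₀ : E}
    (hg : EnvSmoothAt g x₀) (hh : ContDiffAt ℝ ∞ h x₀) :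
    EnvSmoothAt (fun x => DEnv.cons (h x) (g x)) x₀ := by
  intro U v
  cases v with
  | z => exact hh
  | s v => exact hg U v

/-- A bound variable may be taken as a further parameter of a smooth family of environments. -/
theorem EnvSmoothAt.cons_fst {Γ : List Ty} {T : Ty} {g : E → DEnv Γ} {x₀ : E} {a : T.Den}
    (hg : EnvSmoothAt g x₀) :
    EnvSmoothAt (fun q : T.Den × E => DEnv.cons q.1 (g q.2)) (a, x₀) := by
  refine EnvSmoothAt.cons (g := fun q : T.Den × E => g q.2) (h := Prod.fst) ?_ contDiffAt_fst
  intro U v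
  exact ContDiffAt.comp (a, x₀) (g := fun x => g x U v) (hg U v) contDiffAt_snd

theorem EnvSmoothAt.const {Γ : List Ty} (γ : DEnv Γ) (x₀ : E) :
    EnvSmoothAt (fun _ : E => γ) x₀ := fun _ _ => contDiffAt_const

theorem SmoothGerm.congr {s : Srt} {p q : E → Part s.Den} {x₀ : E} (hp : SmoothGerm p x₀)
    (h : ∀ᶠ x in 𝓝 x₀, q x = p x) : SmoothGerm q x₀ := by
  cases s with
  | ty T =>
    obtain ⟨k, hk, he⟩ := hp
    exact ⟨k, hk, by filter_upwards [h, he] with x h₁ h₂ using h₁.trans h₂⟩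
  | bool =>
    obtain ⟨b, he⟩ := hp
    exact ⟨b, by filter_upwards [h, he] with x h₁ h₂ using h₁.trans h₂⟩

end

/-! ### Projections and pairing -/

theorem vfst_vpair {T U : Ty} (a : T.Den) (b : U.Den) : vfst (vpair a b) = a := by
  funext i; simp [vfst, vpair]

theorem vsnd_vpair {T U : Ty} (a : T.Den) (b : U.Den) : vsnd (vpair a b) = b := by
  funext i; simp [vsnd, vpair]

theorem vpair_vfst_vsnd {T U : Ty} (c : (Ty.prod T U).Den) : vpair (vfst c) (vsnd c) = c :=
  Fin.append_castAdd_natAdd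

/-- The first projection, as a continuous linear map. -/
def vfstL (T U : Ty) : (Ty.prod T U).Den →L[ℝ] T.Den :=
  LinearMap.toContinuousLinearMap
    { toFun := vfst, map_add' := fun _ _ => rfl, map_smul' := fun _ _ => rfl }

/-- The second projection, as a continuous linear map. -/
def vsndL (T U : Ty) : (Ty.prod T U).Den →L[ℝ] U.Den :=
  LinearMap.toContinuousLinearMap
    { toFun := vsnd, map_add' := fun _ _ => rfl, map_smul' := fun _ _ => rfl }

theorem vpair_add {T U : Ty} (a a' : T.Den) (b b' : U.Den) :
    vpair (a + a') (b + b') = vpair a b + vpair a' b' := by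
  refine (vpair_vfst_vsnd (vpair a b + vpair a' b')).symm.trans ?_ |>.symm
  congr 1
  · funext i
    change Fin.append a b _ + Fin.append a' b' _ = _
    simp
  · funext i
    change Fin.append a b _ + Fin.append a' b' _ = _
    simp

theorem vpair_smul {T U : Ty} (r : ℝ) (a : T.Den) (b : U.Den) :
    vpair (r • a) (r • b) = r • vpair a b := by
  refine (vpair_vfst_vsnd (r • vpair a b)).symm.trans ?_ |>.symm
  congr 1
  · funext i
    change r * Fin.append a b _ = _
    simp
  · funext i
    change r * Fin.append a b _ = _
    simp

/-- Pairing, as a continuous linear map. -/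
def vpairL (T U : Ty) : T.Den × U.Den →L[ℝ] (Ty.prod T U).Den :=
  LinearMap.toContinuousLinearMap
    { toFun := fun q => vpair q.1 q.2
      map_add' := fun _ _ => vpair_add _ _ _ _
      map_smul' := fun _ _ => vpair_smul _ _ _ }

theorem vpair_zero {T U : Ty} : vpair (0 : T.Den) (0 : U.Den) = 0 := (vpairL T U).map_zero

/-! ### The reverse-mode derivative of a germ -/

/-- The reverse-mode derivative depends only on the germ of the function. -/
theorem PF.revDeriv_congr {n m : ℕ} {f g : PF n m} {x : RV n} (h : ∀ᶠ z in 𝓝 x, f z = g z)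
    (y : RV m) : f.revDeriv x y = g.revDeriv x y := by
  have ht : ∀ i, (fun z => f.total z i) =ᶠ[𝓝 x] fun z => g.total z i := fun i => by
    classical
    filter_upwards [h] with z hz
    exact congrFun (congrArg (fun p : Part (RV m) => p.getOrElse (0 : RV m)) hz) i
  refine Part.ext' ?_ ?_
  · simp only [PF.revDeriv]
    refine and_congr (Filter.eventually_congr ?_) (forall_congr' fun i => forall_congr' fun j => ?_)
    · filter_upwards [h] with z hz
      simp [PF.dom, hz]
    · exact (ht i).lineDifferentiableAt_iff
  · intro _ _
    funext j
    change ∑ i, lineDeriv ℝ (fun z => f.total z i) x (Pi.single j 1) * y i = _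
    exact Finset.sum_congr rfl fun i _ => by rw [(ht i).lineDeriv_eq]

theorem PF.revDeriv_of_hasFDerivAt {n m : ℕ} {f : PF n m} {x : RV n} {h : RV n → RV m}
    {h' : RV n →L[ℝ] RV m} (hh : HasFDerivAt h h' x) (he : ∀ᶠ z in 𝓝 x, f z = Part.some (h z))
    (y : RV m) :
    f.revDeriv x y = Part.some fun j => ∑ i, h' (Pi.single j 1) i * y i := by
  rw [PF.revDeriv_congr (g := fun z => Part.some (h z)) he]
  have ht : ∀ z, PF.total (fun z => Part.some (h z)) z = h z := fun z => PF.total_eq rfl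
  have hl : ∀ i j, HasLineDerivAt ℝ (fun z => h z i) (h' (Pi.single j 1) i) x (Pi.single j 1) :=
    fun i j => ((hasFDerivAt_pi'.1 hh) i).hasLineDerivAt _
  refine Part.ext' ?_ ?_
  · simp only [PF.revDeriv, ht, Part.some_dom, iff_true]
    exact ⟨Filter.Eventually.of_forall fun z => trivial,
      fun i j => (hl i j).lineDifferentiableAt⟩
  · intro _ _
    funext j
    simp only [PF.revDeriv, ht, Part.get_some]
    exact Finset.sum_congr rfl fun i _ => by rw [(hl i j).lineDeriv]

theorem PF.dom_of_revDeriv_dom {n m : ℕ} {f : PF n m} {x : RV n} {y : RV m}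
    (h : (f.revDeriv x y).Dom) : (f x).Dom :=
  h.1.self_of_nhds

/-! ### Smoothness of denotations -/

/-- If a family of partial functions has a smooth germ jointly in the parameter and the
argument, then its reverse-mode derivative has a smooth germ. -/
theorem revDeriv_smoothGerm {E : Type} [NormedAddCommGroup E] [NormedSpace ℝ E] {n m : ℕ}
    {f : E → PF n m} {H : RV n × E → RV m} {l : E → RV n} {y : E → RV m} {x₀ : E}
    (hH : ContDiffAt ℝ ∞ H (l x₀, x₀))
    (he : ∀ᶠ q in 𝓝 (l x₀, x₀), f q.2 q.1 = Part.some (H q))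
    (hl : ContDiffAt ℝ ∞ l x₀) (hy : ContDiffAt ℝ ∞ y x₀) :
    ∃ k : E → RV n, ContDiffAt ℝ ∞ k x₀ ∧
      ∀ᶠ x in 𝓝 x₀, (f x).revDeriv (l x) (y x) = Part.some (k x) := by
  have hc : ContDiffAt ℝ ∞ (fun x => (l x, x)) x₀ := hl.prodMk contDiffAt_id
  have hct : Filter.Tendsto (fun x => (l x, x)) (𝓝 x₀) (𝓝 (l x₀, x₀)) := hc.continuousAt
  refine ⟨fun x j => ∑ i, fderiv ℝ H (l x, x) (Pi.single j 1, 0) i * y x i, ?_, ?_⟩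
  · refine contDiffAt_pi.2 fun j => ContDiffAt.sum fun i _ => ContDiffAt.mul ?_ ?_
    · have h1 : ContDiffAt ℝ ∞ (fderiv ℝ H) (l x₀, x₀) := hH.fderiv_right (by simp)
      have h2 : ContDiffAt ℝ ∞ (fun x => fderiv ℝ H (l x, x)) x₀ :=
        ContDiffAt.comp x₀ (g := fderiv ℝ H) h1 hc
      exact contDiffAt_pi.1 (h2.clm_apply contDiffAt_const) i
    · exact contDiffAt_pi.1 hy i
  · have hd : ∀ᶠ q in 𝓝 (l x₀, x₀), DifferentiableAt ℝ H q := by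
      have h1 : ContDiffAt ℝ 1 H (l x₀, x₀) := hH.of_le (by exact_mod_cast le_top)
      filter_upwards [h1.eventually (by decide)] with q hq using hq.differentiableAt one_ne_zero
    filter_upwards [hct.eventually he.eventually_nhds, hct.eventually hd] with x h₁ h₂
    have hi : HasFDerivAt (fun a : RV n => (a, x))
        (ContinuousLinearMap.inl ℝ (RV n) E) (l x)  :=
      (hasFDerivAt_id (𝕜 := ℝ) (l x)).prodMk (hasFDerivAt_const x (l x))
    have hk := HasFDerivAt.comp (l x) (g := H) h₂.hasFDerivAt hi
    refine (PF.revDeriv_of_hasFDerivAt hk ?_ (y x)).trans ?_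
    · exact (hi.continuousAt.tendsto.eventually h₁)
    · rfl

theorem Interp.pred_locally_const (I : Interp S) {T : Ty} (p : S.Pred T) {x : T.Den} {b : Bool}
    (h : I.pred p x = Part.some b) : ∀ᶠ z in 𝓝 x, I.pred p z = Part.some b := by
  have ho : IsOpen ((I.pred p).preimage {b}) := I.pred_continuous p _ (isOpen_discrete _)
  have hx : x ∈ (I.pred p).preimage {b} := ⟨b, rfl, Part.eq_some_iff.1 h⟩
  filter_upwards [ho.mem_nhds hx] with z hz
  obtain ⟨c, rfl, hc⟩ := hz
  exact Part.eq_some_iff.2 hc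

/-- Denotations of terms are smooth in the ordinary variables, provided that the function variables
denote smooth functions. -/
theorem Tm.den_smooth (I : Interp S) {Φ : List (Ty × Ty)} {Γ : List Ty} {s : Srt}
    (M : Tm S Φ Γ s) (α : DFEnv Φ) (hα : ∀ T U f, (α T U f).Smooth)
    {E : Type} [NormedAddCommGroup E] [NormedSpace ℝ E] (g : E → DEnv Γ) (x₀ : E)
    (hg : EnvSmoothAt g x₀) (hd : (M.den I α (g x₀)).Dom) :
    SmoothGerm (fun x => M.den I α (g x)) x₀ := by
  induction M generalizing E with
  | var v => exact ⟨_, hg _ v, Filter.Eventually.of_forall fun _ => rfl⟩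
  | real r => exact ⟨_, contDiffAt_const (c := vreal r), Filter.Eventually.of_forall fun _ => rfl⟩
  | unit => exact ⟨_, contDiffAt_const (c := vstar), Filter.Eventually.of_forall fun _ => rfl⟩
  | tt => exact ⟨true, Filter.Eventually.of_forall fun _ => rfl⟩
  | ff => exact ⟨false, Filter.Eventually.of_forall fun _ => rfl⟩
  | add M N ihM ihN =>
    obtain ⟨a, ha, hd⟩ := exists_of_bind_dom hd
    obtain ⟨b, hb, -⟩ := exists_of_bind_dom hd
    obtain ⟨h, hh, he⟩ := ihM α hα g x₀ hg (by simp [ha])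
    obtain ⟨k, hk, ke⟩ := ihN α hα g x₀ hg (by simp [hb])
    refine ⟨fun x => h x + k x, hh.add hk, ?_⟩
    filter_upwards [he, ke] with x h₁ h₂
    simp [Tm.den, h₁, h₂]
  | pair M N ihM ihN =>
    obtain ⟨a, ha, hd⟩ := exists_of_bind_dom hd
    obtain ⟨b, hb, -⟩ := exists_of_bind_dom hd
    obtain ⟨h, hh, he⟩ := ihM α hα g x₀ hg (by simp [ha])
    obtain ⟨k, hk, ke⟩ := ihN α hα g x₀ hg (by simp [hb])
    refine ⟨fun x => vpair (h x) (k x),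
      ContDiffAt.comp x₀ (g := vpairL _ _) (vpairL _ _).contDiff.contDiffAt (hh.prodMk hk), ?_⟩
    filter_upwards [he, ke] with x h₁ h₂
    simp [Tm.den, h₁, h₂]
  | fst M ihM =>
    obtain ⟨h, hh, he⟩ := ihM α hα g x₀ hg hd
    refine ⟨fun x => vfst (h x),
      ContDiffAt.comp x₀ (g := vfstL _ _) (vfstL _ _).contDiff.contDiffAt hh, ?_⟩
    filter_upwards [he] with x h₁
    simp [Tm.den, h₁]
  | snd M ihM =>
    obtain ⟨h, hh, he⟩ := ihM α hα g x₀ hg hd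
    refine ⟨fun x => vsnd (h x),
      ContDiffAt.comp x₀ (g := vsndL _ _) (vsndL _ _).contDiff.contDiffAt hh, ?_⟩
    filter_upwards [he] with x h₁
    simp [Tm.den, h₁]
  | op o M ihM =>
    obtain ⟨a, ha, hd⟩ := exists_of_bind_dom hd
    obtain ⟨h, hh, he⟩ := ihM α hα g x₀ hg (by simp [ha])
    obtain rfl : h x₀ = a := Part.some_injective (he.self_of_nhds.symm.trans ha)
    obtain ⟨k, hk, ke⟩ := PF.smooth_iff.1 (I.op_smooth o) _ hd
    refine ⟨fun x => k (h x), ContDiffAt.comp x₀ (g := k) hk hh, ?_⟩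
    filter_upwards [he, hh.continuousAt.eventually ke] with x h₁ h₂
    simp [Tm.den, h₁, h₂]
  | app f M ihM =>
    obtain ⟨a, ha, hd⟩ := exists_of_bind_dom hd
    obtain ⟨h, hh, he⟩ := ihM α hα g x₀ hg (by simp [ha])
    obtain rfl : h x₀ = a := Part.some_injective (he.self_of_nhds.symm.trans ha)
    obtain ⟨k, hk, ke⟩ := PF.smooth_iff.1 (hα _ _ f) _ hd
    refine ⟨fun x => k (h x), ContDiffAt.comp x₀ (g := k) hk hh, ?_⟩
    filter_upwards [he, hh.continuousAt.eventually ke] with x h₁ h₂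
    simp [Tm.den, h₁, h₂]
  | pred p M ihM =>
    obtain ⟨a, ha, hd⟩ := exists_of_bind_dom hd
    obtain ⟨h, hh, he⟩ := ihM α hα g x₀ hg (by simp [ha])
    obtain rfl : h x₀ = a := Part.some_injective (he.self_of_nhds.symm.trans ha)
    obtain ⟨b, hb⟩ := exists_some_of_dom hd
    refine ⟨b, ?_⟩
    filter_upwards [he, hh.continuousAt.eventually (I.pred_locally_const p hb)] with x h₁ h₂
    simp [Tm.den, h₁, h₂]
  | letin M N ihM ihN =>
    obtain ⟨a, ha, hd⟩ := exists_of_bind_dom hd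
    obtain ⟨h, hh, he⟩ := ihM α hα g x₀ hg (by simp [ha])
    obtain rfl : h x₀ = a := Part.some_injective (he.self_of_nhds.symm.trans ha)
    obtain ⟨k, hk, ke⟩ := ihN α hα (fun x => DEnv.cons (h x) (g x)) x₀ (hg.cons hh) hd
    refine ⟨k, hk, ?_⟩
    filter_upwards [he, ke] with x h₁ h₂
    simp [Tm.den, h₁, h₂]
  | ite B M N ihB ihM ihN =>
    obtain ⟨b, hb, hd⟩ := exists_of_bind_dom hd
    obtain ⟨b', he⟩ := ihB α hα g x₀ hg (by simp [hb])
    obtain rfl : b' = b := Part.some_injective (he.self_of_nhds.symm.trans hb)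
    cases b' with
    | true =>
      refine SmoothGerm.congr (ihM α hα g x₀ hg hd) ?_
      filter_upwards [he] with x h₁
      simp [Tm.den, h₁]
    | false =>
      refine SmoothGerm.congr (ihN α hα g x₀ hg hd) ?_
      filter_upwards [he] with x h₁
      simp [Tm.den, h₁]
  | letrec M N _ ihN =>
    refine ihN _ ?_ g x₀ hg hd
    intro T U f
    cases f with
    | z => exact mu_smooth _
    | s f => exact hα _ _ f
  | rd N L M ihN ihL ihM =>
    obtain ⟨a, ha, hd⟩ := exists_of_bind_dom hd
    obtain ⟨b, hb, hd⟩ := exists_of_bind_dom hd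
    obtain ⟨l, hl, he⟩ := ihL α hα g x₀ hg (by simp [ha])
    obtain ⟨y, hy, ye⟩ := ihM α hα g x₀ hg (by simp [hb])
    obtain rfl : l x₀ = a := Part.some_injective (he.self_of_nhds.symm.trans ha)
    obtain ⟨H, hH, hHe⟩ := ihN α hα (fun q : _ × E => DEnv.cons q.1 (g q.2)) (l x₀, x₀)
      hg.cons_fst (PF.dom_of_revDeriv_dom hd)
    obtain ⟨k, hk, ke⟩ := revDeriv_smoothGerm
      (f := fun x a => N.den I α (DEnv.cons a (g x))) hH hHe hl hy
    refine ⟨k, hk, ?_⟩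
    filter_upwards [he, ye, ke] with x h₁ h₂ h₃
    simp [Tm.den, h₁, h₂, h₃]

/-! ### Continuity of denotations in the function variables -/

/-- `P` is the supremum of the increasing sequence `p` of partial elements. -/
structure IsChainSup {A : Type*} (p : ℕ → Part A) (P : Part A) : Prop where
  mono : Monotone p
  mem_iff : ∀ v, v ∈ P ↔ ∃ k, v ∈ p k

namespace IsChainSup

variable {A B : Type*}

theorem const (P : Part A) : IsChainSup (fun _ => P) P :=
  ⟨monotone_const, fun _ => ⟨fun h => ⟨0, h⟩, fun ⟨_, h⟩ => h⟩⟩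

theorem bind {p : ℕ → Part A} {P : Part A} {q : ℕ → A → Part B} {Q : A → Part B}
    (hp : IsChainSup p P) (hq : ∀ a, IsChainSup (fun k => q k a) (Q a)) :
    IsChainSup (fun k => (p k).bind (q k)) (P.bind Q) := by
  refine ⟨fun k l hkl v hv => ?_, fun v => ⟨fun hv => ?_, fun ⟨k, hv⟩ => ?_⟩⟩
  · obtain ⟨a, ha, hb⟩ := Part.mem_bind_iff.1 hv
    exact Part.mem_bind (hp.mono hkl _ ha) ((hq a).mono hkl _ hb)
  · obtain ⟨a, ha, hb⟩ := Part.mem_bind_iff.1 hv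
    obtain ⟨k, hk⟩ := (hp.mem_iff a).1 ha
    obtain ⟨l, hl⟩ := ((hq a).mem_iff v).1 hb
    exact ⟨max k l, Part.mem_bind (hp.mono (le_max_left k l) _ hk)
      ((hq a).mono (le_max_right k l) _ hl)⟩
  · obtain ⟨a, ha, hb⟩ := Part.mem_bind_iff.1 hv
    exact Part.mem_bind ((hp.mem_iff a).2 ⟨k, ha⟩) (((hq a).mem_iff v).2 ⟨k, hb⟩)

theorem map {p : ℕ → Part A} {P : Part A} (f : A → B) (hp : IsChainSup p P) :
    IsChainSup (fun k => (p k).map f) (P.map f) := by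
  simp only [← Part.bind_some_eq_map]
  exact hp.bind fun a => const _

theorem le {p : ℕ → Part A} {P : Part A} (hp : IsChainSup p P) (k : ℕ) : p k ≤ P :=
  fun v hv => (hp.mem_iff v).2 ⟨k, hv⟩

/-- Continuity on such chains of two elements gives monotonicity. -/
theorem of_le {P Q : Part A} (h : P ≤ Q) : IsChainSup (fun k : ℕ => if k = 0 then P else Q) Q := by
  refine ⟨monotone_nat_of_le_succ fun k => ?_, fun v => ⟨fun hv => ⟨1, by simpa using hv⟩, ?_⟩⟩
  · by_cases hk : k = 0 <;> simp [hk, h]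
  · rintro ⟨k, hk⟩
    split_ifs at hk with h0
    exacts [h v hk, hk]

theorem exists_of_mono {p : ℕ → Part A} (hp : Monotone p) : ∃ P, IsChainSup p P :=
  ⟨OmegaCompletePartialOrder.ωSup ⟨p, hp⟩, hp, fun v =>
    (Part.mem_ωSup v ⟨p, hp⟩).trans
      (exists_congr fun _ => eq_comm.trans Part.eq_some_iff)⟩

end IsChainSup

/-- A smooth partial function agrees with its extensions near each point of its (open) domain. -/
theorem PF.Smooth.eventually_eq_of_le {n m : ℕ} {f g : PF n m} (hf : f.Smooth) (h : f ≤ g)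
    {x : RV n} (hx : (f x).Dom) : ∀ᶠ z in 𝓝 x, g z = f z := by
  filter_upwards [hf.1.mem_nhds hx] with z hz
  have := PF.eq_some_total hz
  rw [this]
  exact Part.eq_some_iff.2 (h z _ (Part.eq_some_iff.1 this))

theorem IsChainSup.smooth {n m : ℕ} {p : ℕ → PF n m} {P : PF n m} (hs : ∀ k, (p k).Smooth)
    (h : ∀ x, IsChainSup (fun k => p k x) (P x)) : P.Smooth := by
  refine PF.smooth_iff.2 fun x hx => ?_
  obtain ⟨v, hv⟩ := Part.dom_iff_mem.1 hx
  obtain ⟨k, hk⟩ := ((h x).mem_iff v).1 hv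
  have hd : (p k x).Dom := Part.dom_iff_mem.2 ⟨v, hk⟩
  obtain ⟨f, hf, he⟩ := PF.smooth_iff.1 (hs k) x hd
  refine ⟨f, hf, ?_⟩
  filter_upwards [he, (hs k).eventually_eq_of_le (fun z => (h z).le k) hd] with z h₁ h₂
  exact h₂.trans h₁

/-- The reverse-mode derivative is continuous on smooth partial functions: since domains are open,
the germ of the supremum of a chain at a point of its domain is that of a member of the chain. -/
theorem IsChainSup.revDeriv {n m : ℕ} {p : ℕ → PF n m} {P : PF n m} (hs : ∀ k, (p k).Smooth)
    (h : ∀ x, IsChainSup (fun k => p k x) (P x)) (x : RV n) (y : RV m) :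
    IsChainSup (fun k => (p k).revDeriv x y) (P.revDeriv x y) := by
  have key : ∀ k, (p k x).Dom → P.revDeriv x y = (p k).revDeriv x y := fun k hk =>
    PF.revDeriv_congr ((hs k).eventually_eq_of_le (fun z => (h z).le k) hk) y
  have hdom : ∀ {f : PF n m} {v}, v ∈ f.revDeriv x y → (f x).Dom := fun hv =>
    PF.dom_of_revDeriv_dom (Part.dom_iff_mem.2 ⟨_, hv⟩)
  refine ⟨fun k l hkl v hv => ?_, fun v => ⟨fun hv => ?_, fun ⟨k, hv⟩ => ?_⟩⟩
  · have hk := hdom hv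
    have hl : (p l x).Dom := by
      obtain ⟨w, hw⟩ := Part.dom_iff_mem.1 hk
      exact Part.dom_iff_mem.2 ⟨w, (h x).mono hkl _ hw⟩
    rwa [← key l hl, key k hk]
  · obtain ⟨w, hw⟩ := Part.dom_iff_mem.1 (hdom hv)
    obtain ⟨k, hk⟩ := ((h x).mem_iff w).1 hw
    exact ⟨k, by rwa [← key k (Part.dom_iff_mem.2 ⟨w, hk⟩)]⟩
  · rwa [key k (hdom hv)]

/-- A functional on partial functions that preserves smoothness, and the suprema of chains of
smooth partial functions. -/
structure SmoothContinuous {n m : ℕ} (F : PF n m → PF n m) : Prop where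
  smooth : ∀ f, f.Smooth → (F f).Smooth
  sup : ∀ (p : ℕ → PF n m) (P : PF n m), (∀ k, (p k).Smooth) →
    (∀ x, IsChainSup (fun k => p k x) (P x)) → ∀ x, IsChainSup (fun k => F (p k) x) (F P x)

namespace SmoothContinuous

variable {n m : ℕ} {F : PF n m → PF n m}

theorem mono (hF : SmoothContinuous F) {f g : PF n m} (hf : f.Smooth) (hg : g.Smooth)
    (h : f ≤ g) : F f ≤ F g := fun x => by
  have := (hF.sup (fun k => if k = 0 then f else g) g (fun k => by split_ifs <;> assumption)
    (fun x => by
      have := IsChainSup.of_le (h x)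
      convert this using 2
      split_ifs <;> rfl) x).le 0
  simpa using this

theorem iterate_smooth (hF : SmoothContinuous F) (k : ℕ) : (F^[k] ⊥).Smooth := by
  induction k with
  | zero => exact PF.smooth_bot
  | succ k ih =>
    rw [Function.iterate_succ_apply']
    exact hF.smooth _ ih

theorem iterate_mono (hF : SmoothContinuous F) : Monotone fun k => F^[k] (⊥ : PF n m) := by
  refine monotone_nat_of_le_succ fun k => ?_
  induction k with
  | zero => exact bot_le
  | succ k ih =>
    rw [Function.iterate_succ_apply', Function.iterate_succ_apply' F (k + 1)]
    exact hF.mono (hF.iterate_smooth k) (hF.iterate_smooth (k + 1)) ih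

/-- Kleene's fixed point theorem.  In particular the least smooth fixed point exists, so that `mu F`
does not take its default value. -/
theorem isChainSup_mu (hF : SmoothContinuous F) (x : RV n) :
    IsChainSup (fun k => F^[k] ⊥ x) (mu F x) := by
  choose L hL using fun x => IsChainSup.exists_of_mono (p := fun k => F^[k] (⊥ : PF n m) x)
    fun k l hkl => hF.iterate_mono hkl x
  have hLs : PF.Smooth L := IsChainSup.smooth hF.iterate_smooth hL
  have hfix : F L = L := by
    funext x
    refine Part.ext fun v => ?_
    rw [(hF.sup _ L hF.iterate_smooth hL x).mem_iff, (hL x).mem_iff]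
    constructor
    · rintro ⟨k, hk⟩
      exact ⟨k + 1, by rwa [Function.iterate_succ_apply']⟩
    · rintro ⟨k, hk⟩
      cases k with
      | zero => exact absurd hk (Part.notMem_none v)
      | succ k => exact ⟨k, by rwa [Function.iterate_succ_apply'] at hk⟩
  have hleast : IsLeast {f : PF n m | f.Smooth ∧ F f = f} L := by
    refine ⟨⟨hLs, hfix⟩, fun g hg x v hv => ?_⟩
    obtain ⟨k, hk⟩ := ((hL x).mem_iff v).1 hv
    have : ∀ k, F^[k] ⊥ ≤ g := fun k => by
      induction k with
      | zero => exact bot_le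
      | succ k ih =>
        rw [Function.iterate_succ_apply', ← hg.2]
        exact hF.mono (hF.iterate_smooth k) hg.1 ih
    exact this k x v hk
  have hmu : mu F = L := by
    have h : ∃ f, IsLeast {f : PF n m | f.Smooth ∧ F f = f} f := ⟨L, hleast⟩
    rw [mu, dif_pos h]
    exact h.choose_spec.unique hleast
  rw [hmu]
  exact hL x

end SmoothContinuous

/-- `b` is the supremum of the increasing sequence `β` of semantic function environments. -/
def DFEnv.IsSup {Φ : List (Ty × Ty)} (β : ℕ → DFEnv Φ) (b : DFEnv Φ) : Prop :=
  ∀ T U f x, IsChainSup (fun k => β k T U f x) (b T U f x)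

theorem DFEnv.IsSup.cons {Φ : List (Ty × Ty)} {T U : Ty} {β : ℕ → DFEnv Φ} {b : DFEnv Φ}
    {p : ℕ → PF T.dim U.dim} {P : PF T.dim U.dim} (h : DFEnv.IsSup β b)
    (hp : ∀ x, IsChainSup (fun k => p k x) (P x)) :
    DFEnv.IsSup (fun k => DFEnv.cons (p k) (β k)) (DFEnv.cons P b) := by
  intro T U f x
  cases f with
  | z => exact hp x
  | s f => exact h T U f x

/-- Smooth semantic function environments: all function variables denote smooth functions. -/
def DFEnv.Smooth {Φ : List (Ty × Ty)} (α : DFEnv Φ) : Prop := ∀ T U f, (α T U f).Smooth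

theorem DFEnv.Smooth.cons {Φ : List (Ty × Ty)} {T U : Ty} {α : DFEnv Φ} {f : PF T.dim U.dim}
    (hα : α.Smooth) (hf : f.Smooth) : (DFEnv.cons f α).Smooth := by
  intro T U v
  cases v with
  | z => exact hf
  | s v => exact hα T U v

/-- The functional whose least fixed point a recursive definition denotes. -/
def recFun (I : Interp S) {Φ : List (Ty × Ty)} {T U : Ty}
    (M : Tm S ((T, U) :: Φ) [T] (.ty U)) (α : DFEnv Φ) (f : PF T.dim U.dim) : PF T.dim U.dim :=
  fun a => M.den I (DFEnv.cons f α) (DEnv.cons a DEnv.nil)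

/-- A term with smooth function variables denotes a smooth partial function of its most recently
bound variable. -/
theorem Tm.den_cons_smooth (I : Interp S) {Φ : List (Ty × Ty)} {Γ : List Ty} {T U : Ty}
    (M : Tm S Φ (T :: Γ) (.ty U)) {α : DFEnv Φ} (hα : α.Smooth) (γ : DEnv Γ) :
    PF.Smooth (n := T.dim) (m := U.dim) fun a => M.den I α (DEnv.cons a γ) :=
  PF.smooth_iff.2 fun x hx => M.den_smooth I α hα (fun a : T.Den => DEnv.cons a γ) x
    ((EnvSmoothAt.const γ x).cons contDiffAt_id) hx

/-- Denotations of terms are continuous in the (smooth) function variables. -/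
theorem Tm.den_isChainSup (I : Interp S) {Φ : List (Ty × Ty)} {Γ : List Ty} {s : Srt}
    (M : Tm S Φ Γ s) (β : ℕ → DFEnv Φ) (b : DFEnv Φ) (hβ : ∀ k, (β k).Smooth)
    (hb : DFEnv.IsSup β b) (γ : DEnv Γ) :
    IsChainSup (fun k => M.den I (β k) γ) (M.den I b γ) := by
  induction M with
  | var v => exact .const _
  | real r => exact .const _
  | unit => exact .const _
  | tt => exact .const _
  | ff => exact .const _
  | add M N ihM ihN =>
    exact (ihM β b hβ hb γ).bind fun _ => (ihN β b hβ hb γ).bind fun _ => .const _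
  | pair M N ihM ihN =>
    exact (ihM β b hβ hb γ).bind fun _ => (ihN β b hβ hb γ).bind fun _ => .const _
  | fst M ihM => exact (ihM β b hβ hb γ).map _
  | snd M ihM => exact (ihM β b hβ hb γ).map _
  | op o M ihM => exact (ihM β b hβ hb γ).bind fun _ => .const _
  | pred p M ihM => exact (ihM β b hβ hb γ).bind fun _ => .const _
  | app f M ihM => exact (ihM β b hβ hb γ).bind fun a => hb _ _ f a
  | letin M N ihM ihN => exact (ihM β b hβ hb γ).bind fun a => ihN β b hβ hb _
  | ite B M N ihB ihM ihN =>
    refine (ihB β b hβ hb γ).bind fun c => ?_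
    cases c with
    | true => exact ihM β b hβ hb γ
    | false => exact ihN β b hβ hb γ
  | rd N L M ihN ihL ihM =>
    exact (ihL β b hβ hb γ).bind fun x => (ihM β b hβ hb γ).bind fun y =>
      IsChainSup.revDeriv (fun k => N.den_cons_smooth I (hβ k) γ) (fun a => ihN β b hβ hb _) x y
  | letrec M N ihM ihN =>
    have hbs : b.Smooth := fun T U f => IsChainSup.smooth (fun k => hβ k T U f) (hb T U f)
    have hF : ∀ α : DFEnv _, α.Smooth → SmoothContinuous (recFun I M α) := fun α hα =>
      ⟨fun f hf => M.den_cons_smooth I (hα.cons hf) _, fun p P hp hP x =>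
        ihM (fun k => DFEnv.cons (p k) α) _ (fun k => hα.cons (hp k))
          (DFEnv.IsSup.cons (fun _ _ _ _ => .const _) hP) _⟩
    -- each Kleene iterate is continuous in the function variables; the suprema over the iterates
    -- and over the chain may then be exchanged
    have hit : ∀ j x,
        IsChainSup (fun k => (recFun I M (β k))^[j] ⊥ x) ((recFun I M b)^[j] ⊥ x) := by
      intro j
      induction j with
      | zero => exact fun x => .const _
      | succ j ih =>
        intro x
        simp only [Function.iterate_succ_apply']
        exact ihM (fun k => DFEnv.cons ((recFun I M (β k))^[j] ⊥) (β k)) _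
          (fun k => (hβ k).cons ((hF _ (hβ k)).iterate_smooth j)) (hb.cons ih) _
    refine ihN (fun k => DFEnv.cons (mu (recFun I M (β k))) (β k)) _
      (fun k => (hβ k).cons (mu_smooth _)) (hb.cons (P := mu (recFun I M b)) fun x => ?_) γ
    have hk := fun k => (hF _ (hβ k)).isChainSup_mu x
    refine ⟨fun k l hkl v hv => ?_, fun v => ?_⟩
    · obtain ⟨j, hj⟩ := ((hk k).mem_iff v).1 hv
      exact ((hk l).mem_iff v).2 ⟨j, (hit j x).mono hkl v hj⟩
    · rw [((hF b hbs).isChainSup_mu x).mem_iff]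
      simp only [(hit _ x).mem_iff, (hk _).mem_iff]
      exact exists_comm

theorem recFun_smoothContinuous (I : Interp S) {Φ : List (Ty × Ty)} {T U : Ty}
    (M : Tm S ((T, U) :: Φ) [T] (.ty U)) {α : DFEnv Φ} (hα : α.Smooth) :
    SmoothContinuous (recFun I M α) :=
  ⟨fun _ hf => M.den_cons_smooth I (hα.cons hf) _, fun p _ hp hP _ =>
    M.den_isChainSup I (fun k => DFEnv.cons (p k) α) _ (fun k => hα.cons (hp k))
      (DFEnv.IsSup.cons (fun _ _ _ _ => .const _) hP) _⟩

/-! ### Renaming, values, and evaluation contexts -/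

/-- The semantic environment `γ ∘ θ`. -/
def DEnv.comap {Γ Δ : List Ty} (θ : Ren Γ Δ) (γ : DEnv Δ) : DEnv Γ := fun T v => γ T (θ T v)

theorem DEnv.comap_lift {Γ Δ : List Ty} {T : Ty} (θ : Ren Γ Δ) (a : T.Den) (γ : DEnv Δ) :
    (DEnv.cons a γ).comap (θ.lift T) = DEnv.cons a (γ.comap θ) := by
  funext U v
  cases v <;> rfl

theorem DEnv.comap_wk1 {Γ : List Ty} {T : Ty} (a : T.Den) (γ : DEnv Γ) :
    (DEnv.cons a γ).comap (wk1 T) = γ := rfl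

theorem Tm.den_rename (I : Interp S) {Φ : List (Ty × Ty)} {Γ Δ : List Ty} {s : Srt}
    (M : Tm S Φ Γ s) (θ : Ren Γ Δ) (α : DFEnv Φ) (γ : DEnv Δ) :
    (M.rename θ).den I α γ = M.den I α (γ.comap θ) := by
  induction M generalizing Δ <;>
    simp_all only [Tm.rename, Tm.den, DEnv.comap_lift]
  rfl

theorem Val.den_rename {Γ Δ : List Ty} {T : Ty} (V : Val Γ T) (θ : Ren Γ Δ) (γ : DEnv Δ) :
    (V.rename θ).den γ = V.den (γ.comap θ) := by
  induction V <;> simp_all only [Val.rename, Val.den]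
  rfl

theorem Val.den_toTm (I : Interp S) {Φ : List (Ty × Ty)} {Γ : List Ty} {T : Ty} (V : Val Γ T)
    (α : DFEnv Φ) (γ : DEnv Γ) : V.toTm.den I α γ = Part.some (V.den γ) := by
  unfold Val.toTm
  induction V <;> simp_all [Val.toTr, Tr.toTm, Tm.den, Val.den]

theorem Val.toTm_rename {Φ : List (Ty × Ty)} {Γ Δ : List Ty} {T : Ty} (V : Val Γ T)
    (θ : Ren Γ Δ) : ((V.rename θ).toTm : Tm S Φ Δ _) = V.toTm.rename θ := by
  unfold Val.toTm
  induction V <;> simp_all [Val.rename, Val.toTr, Tr.toTm, Tm.rename]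

theorem Val.cden_subst {Γ : List Ty} {T : Ty} (V : Val Γ T) (ρ : VEnv Γ) :
    (V.subst ρ).cden = V.den ρ.den := by
  unfold Val.cden
  induction V <;> simp_all only [Val.subst, Val.den]
  rfl

theorem VEnv.den_cons {Γ : List Ty} {T : Ty} (V : ClosedVal T) (ρ : VEnv Γ) :
    (ρ.cons V).den = DEnv.cons V.cden ρ.den := by
  funext U v
  cases v <;> rfl

theorem Val.den_smooth {E : Type} [NormedAddCommGroup E] [NormedSpace ℝ E] {Γ : List Ty} {T : Ty}
    (V : Val Γ T) {g : E → DEnv Γ} {x₀ : E} (hg : EnvSmoothAt g x₀) :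
    ContDiffAt ℝ ∞ (fun x => V.den (g x)) x₀ := by
  induction V with
  | var v => exact hg _ v
  | real r => exact contDiffAt_const (c := vreal r)
  | unit => exact contDiffAt_const (c := vstar)
  | pair V W ihV ihW =>
    exact ContDiffAt.comp x₀ (g := vpairL _ _) (vpairL _ _).contDiff.contDiffAt (ihV.prodMk ihW)

theorem ClosedVal.eq_pair {T U : Ty} (V : ClosedVal (.prod T U)) :
    ∃ V₁ V₂, V = Val.pair V₁ V₂ := by
  cases V with
  | var v => nomatch v
  | pair V₁ V₂ => exact ⟨V₁, V₂, rfl⟩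

theorem ClosedVal.eq_real (V : ClosedVal .real) : ∃ r, V = Val.real r := by
  cases V with
  | var v => nomatch v
  | real r => exact ⟨r, rfl⟩

/-- Evaluation contexts are strict and linear in their hole, which is evaluated first. -/
theorem ECtx.den_plug (I : Interp S) {Φ : List (Ty × Ty)} {Γ : List Ty} {T : Ty} {s : Srt}
    (E : ECtx S Φ Γ (.ty T) s) (P : Tm S Φ Γ (.ty T)) (α : DFEnv Φ) (γ : DEnv Γ) :
    (E.plug P).den I α γ =
      (P.den I α γ).bind fun a => E.plugVar.den I α (DEnv.cons a γ) := by
  unfold ECtx.plugVar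
  induction E <;>
    simp_all only [ECtx.plug, ECtx.rename, Tm.den, Part.bind_assoc, Part.map_bind,
      Tm.den_rename, Val.den_toTm, Val.toTm_rename, DEnv.comap_lift, DEnv.comap_wk1,
      Part.bind_some]
  exact (Part.bind_some_right _).symm

theorem Tm.den_ofBool (I : Interp S) {Φ : List (Ty × Ty)} {Γ : List Ty} (b : Bool)
    (α : DFEnv Φ) (γ : DEnv Γ) : (Tm.ofBool b).den I α γ = Part.some b := by
  cases b <;> rfl

theorem ECtx.den_plug_bool (I : Interp S) {Φ : List (Ty × Ty)} {Γ : List Ty} {s : Srt}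
    (E : ECtx S Φ Γ .bool s) (P : Tm S Φ Γ .bool) (α : DFEnv Φ) (γ : DEnv Γ) :
    (E.plug P).den I α γ =
      (P.den I α γ).bind fun b => (E.plug (Tm.ofBool b)).den I α γ := by
  induction E <;>
    simp_all only [ECtx.plug, Tm.den, Part.bind_assoc, Part.map_bind,
      Val.den_toTm, Part.bind_some]
  simp only [Tm.den_ofBool]
  exact (Part.bind_some_right _).symm

/-- The weight of a term: nodes for recursive definitions, applications and derivatives
have weight `h`, all other nodes have weight `l`.  Weight `1 1` is the size of a term, and the
terms with `weight 0 1 = 0` are those without recursion, application and differentiation. -/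
def Tm.weight (l h : ℕ) : {Φ : List (Ty × Ty)} → {Γ : List Ty} → {s : Srt} → Tm S Φ Γ s → ℕ
  | _, _, _, .var _ => l
  | _, _, _, .real _ => l
  | _, _, _, .add M N => l + M.weight l h + N.weight l h
  | _, _, _, .op _ M => l + M.weight l h
  | _, _, _, .letin M N => l + M.weight l h + N.weight l h
  | _, _, _, .unit => l
  | _, _, _, .pair M N => l + M.weight l h + N.weight l h
  | _, _, _, .fst M => l + M.weight l h
  | _, _, _, .snd M => l + M.weight l h
  | _, _, _, .ite B M N => l + B.weight l h + M.weight l h + N.weight l h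
  | _, _, _, .letrec M N => h + M.weight l h + N.weight l h
  | _, _, _, .app _ M => h + M.weight l h
  | _, _, _, .rd N L M => h + N.weight l h + L.weight l h + M.weight l h
  | _, _, _, .pred _ M => l + M.weight l h
  | _, _, _, .tt => l
  | _, _, _, .ff => l

/-- The weight of an evaluation context, not counting the hole. -/
def ECtx.weight (l h : ℕ) {Φ : List (Ty × Ty)} {Γ : List Ty} {k : Srt} :
    {s : Srt} → ECtx S Φ Γ k s → ℕ
  | _, .hole => 0
  | _, .addL E N => l + E.weight l h + N.weight l h
  | _, .addR V E => l + (V.toTm : Tm S Φ Γ _).weight l h + E.weight l h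
  | _, .op _ E => l + E.weight l h
  | _, .letin E N => l + E.weight l h + N.weight l h
  | _, .pairL E N => l + E.weight l h + N.weight l h
  | _, .pairR V E => l + (V.toTm : Tm S Φ Γ _).weight l h + E.weight l h
  | _, .fst E => l + E.weight l h
  | _, .snd E => l + E.weight l h
  | _, .ite E M N => l + E.weight l h + M.weight l h + N.weight l h
  | _, .app _ E => h + E.weight l h
  | _, .rdL N E M => h + N.weight l h + E.weight l h + M.weight l h
  | _, .rdR N V E => h + N.weight l h + (V.toTm : Tm S Φ Γ _).weight l h + E.weight l h
  | _, .pred _ E => l + E.weight l h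

theorem Tm.weight_rename (l h : ℕ) {Φ : List (Ty × Ty)} {Γ Δ : List Ty} {s : Srt}
    (M : Tm S Φ Γ s) (θ : Ren Γ Δ) : (M.rename θ).weight l h = M.weight l h := by
  induction M generalizing Δ <;> simp_all only [Tm.rename, Tm.weight]

theorem ECtx.weight_rename (l h : ℕ) {Φ : List (Ty × Ty)} {Γ Δ : List Ty} {k s : Srt}
    (E : ECtx S Φ Γ k s) (θ : Ren Γ Δ) : (E.rename θ).weight l h = E.weight l h := by
  induction E <;>
    simp_all only [ECtx.rename, ECtx.weight, Tm.weight_rename, Val.toTm_rename]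

theorem ECtx.weight_plug (l h : ℕ) {Φ : List (Ty × Ty)} {Γ : List Ty} {k s : Srt}
    (E : ECtx S Φ Γ k s) (P : Tm S Φ Γ k) :
    (E.plug P).weight l h = E.weight l h + P.weight l h := by
  induction E <;> simp_all only [ECtx.plug, ECtx.weight, Tm.weight] <;> omega

theorem ECtx.weight_plugVar (l h : ℕ) {Φ : List (Ty × Ty)} {Γ : List Ty} {T : Ty} {s : Srt}
    (E : ECtx S Φ Γ (.ty T) s) : E.plugVar.weight l h = E.weight l h + l := by
  rw [ECtx.plugVar, ECtx.weight_plug, ECtx.weight_rename, Tm.weight]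

theorem Tm.weight_ofBool (l h : ℕ) {Φ : List (Ty × Ty)} {Γ : List Ty} (b : Bool) :
    (Tm.ofBool b : Tm S Φ Γ .bool).weight l h = l := by
  cases b <;> rfl

theorem Tm.one_le_size {Φ : List (Ty × Ty)} {Γ : List Ty} {s : Srt} (M : Tm S Φ Γ s) :
    1 ≤ M.weight 1 1 := by
  cases M <;> simp only [Tm.weight] <;> omega

theorem Redex.one_lt_size {Φ : List (Ty × Ty)} {Γ : List Ty} {s : Srt} {R : Tm S Φ Γ s}
    (h : Redex R) : 1 < R.weight 1 1 := by
  have := @Tm.one_le_size S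
  cases h <;> simp only [Tm.weight] <;> grind

theorem Tr.weight_toTm {Φ : List (Ty × Ty)} {Γ : List Ty} {T : Ty} (C : Tr S Γ T) :
    (C.toTm : Tm S Φ Γ _).weight 0 1 = 0 := by
  induction C <;> simp_all only [Tr.toTm, Tm.weight]

/-- A term is a value, or a boolean value, or of the form `E[R]` with a redex `R`. -/
inductive Decomposed {Φ : List (Ty × Ty)} {Γ : List Ty} : {s : Srt} → Tm S Φ Γ s → Prop
  | val {T : Ty} (V : Val Γ T) : Decomposed V.toTm
  | bval (b : Bool) : Decomposed (.ofBool b)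
  | plug {k s : Srt} (E : ECtx S Φ Γ k s) (R : Tm S Φ Γ k) : Redex R → Decomposed (E.plug R)

theorem Tm.decomposed {Φ : List (Ty × Ty)} {Γ : List Ty} {s : Srt} (M : Tm S Φ Γ s) :
    Decomposed M := by
  induction M with
  | var v => exact .val (.var v)
  | real r => exact .val (.real r)
  | unit => exact .val .unit
  | tt => exact .bval true
  | ff => exact .bval false
  | add M N ihM ihN =>
    cases ihM with
    | plug E R h => exact .plug (.addL E N) R h
    | val V =>
      cases ihN with
      | plug E R h => exact .plug (.addR V E) R h
      | val W => exact .plug .hole _ (.add V W)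
  | pair M N ihM ihN =>
    cases ihM with
    | plug E R h => exact .plug (.pairL E N) R h
    | val V =>
      cases ihN with
      | plug E R h => exact .plug (.pairR V E) R h
      | val W => exact .val (.pair V W)
  | op o M ihM =>
    cases ihM with
    | plug E R h => exact .plug (.op o E) R h
    | val V => exact .plug .hole _ (.op o V)
  | letin M N ihM _ =>
    cases ihM with
    | plug E R h => exact .plug (.letin E N) R h
    | val V => exact .plug .hole _ (.letin V N)
  | fst M ihM =>
    cases ihM with
    | plug E R h => exact .plug (.fst E) R h
    | val V => exact .plug .hole _ (.fst V)
  | snd M ihM =>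
    cases ihM with
    | plug E R h => exact .plug (.snd E) R h
    | val V => exact .plug .hole _ (.snd V)
  | ite B M N ihB _ _ =>
    cases ihB with
    | plug E R h => exact .plug (.ite E M N) R h
    | bval b => exact .plug .hole _ (.ite b M N)
  | letrec M N _ _ => exact .plug .hole _ (.letrec M N)
  | app f M ihM =>
    cases ihM with
    | plug E R h => exact .plug (.app f E) R h
    | val V => exact .plug .hole _ (.app f V)
  | rd N L M _ ihL ihM =>
    cases ihL with
    | plug E R h => exact .plug (.rdL N E M) R h
    | val V =>
      cases ihM with
      | plug E R h => exact .plug (.rdR N V E) R h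
      | val W => exact .plug .hole _ (.rd N V W)
  | pred p M ihM =>
    cases ihM with
    | plug E R h => exact .plug (.pred p E) R h
    | val V => exact .plug .hole _ (.pred p V)

/-! ### Correctness of the symbolic derivative of trace terms -/

/-- The denotation of a trace term. -/
def Tr.den (I : Interp S) {Γ : List Ty} {T : Ty} (C : Tr S Γ T) (γ : DEnv Γ) : Part T.Den :=
  (C.toTm : Tm S [] Γ _).den I (fun _ _ f => nomatch f) γ

theorem Tr.den_toTm (I : Interp S) {Φ : List (Ty × Ty)} {Γ : List Ty} {T : Ty} (C : Tr S Γ T)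
    (α : DFEnv Φ) (γ : DEnv Γ) : C.toTm.den I α γ = C.den I γ := by
  unfold Tr.den
  induction C <;> simp_all only [Tr.toTm, Tm.den]

section
variable (I : Interp S) {Γ : List Ty} {T U : Ty} (γ : DEnv Γ)

theorem Tr.den_var (v : Var Γ T) : (Tr.var v : Tr S Γ T).den I γ = Part.some (γ T v) := rfl
theorem Tr.den_unit : (Tr.unit : Tr S Γ _).den I γ = Part.some vstar := rfl
theorem Tr.den_add (C D : Tr S Γ .real) : (Tr.add C D).den I γ =
    (C.den I γ).bind fun a => (D.den I γ).bind fun b => Part.some (a + b : RV 1) := rfl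
theorem Tr.den_op (o : S.Op T U) (C : Tr S Γ T) :
    (Tr.op o C).den I γ = (C.den I γ).bind fun a => I.op o a := rfl
theorem Tr.den_letin (C : Tr S Γ T) (D : Tr S (T :: Γ) U) : (Tr.letin C D).den I γ =
    (C.den I γ).bind fun a => D.den I (DEnv.cons a γ) := rfl
theorem Tr.den_pair (C : Tr S Γ T) (D : Tr S Γ U) : (Tr.pair C D).den I γ =
    (C.den I γ).bind fun a => (D.den I γ).bind fun b => Part.some (vpair a b) := rfl
theorem Tr.den_fst (C : Tr S Γ (.prod T U)) : (Tr.fst C).den I γ = (C.den I γ).map vfst := rfl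
theorem Tr.den_snd (C : Tr S Γ (.prod T U)) : (Tr.snd C).den I γ = (C.den I γ).map vsnd := rfl

theorem Tr.den_val (V : Val Γ T) : (V.toTr : Tr S Γ T).den I γ = Part.some (V.den γ) :=
  V.den_toTm I _ γ

theorem Tr.toTm_rename {Φ : List (Ty × Ty)} {Δ : List Ty} (C : Tr S Γ T) (θ : Ren Γ Δ) :
    ((C.rename θ).toTm : Tm S Φ Δ _) = C.toTm.rename θ := by
  induction C generalizing Δ <;> simp_all only [Tr.rename, Tr.toTm, Tm.rename]

theorem Tr.den_rename {Δ : List Ty} (C : Tr S Γ T) (θ : Ren Γ Δ) (γ : DEnv Δ) :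
    (C.rename θ).den I γ = C.den I (γ.comap θ) := by
  rw [Tr.den, Tr.toTm_rename, Tm.den_rename]
  rfl

theorem Tr.den_smooth {E : Type} [NormedAddCommGroup E] [NormedSpace ℝ E] (C : Tr S Γ T)
    {g : E → DEnv Γ} {x₀ : E} (hg : EnvSmoothAt g x₀) (hd : (C.den I (g x₀)).Dom) :
    ∃ h : E → T.Den, ContDiffAt ℝ ∞ h x₀ ∧
      ∀ᶠ x in 𝓝 x₀, C.den I (g x) = Part.some (h x) :=
  Tm.den_smooth I C.toTm _ (fun _ _ f => by nomatch f) g x₀ hg hd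

end

theorem Val.den_zero {Γ : List Ty} (T : Ty) (γ : DEnv Γ) : (Val.zero T).den γ = 0 := by
  induction T with
  | real => rfl
  | unit => exact funext fun i => i.elim0
  | prod T U ihT ihU => rw [Val.zero, Val.den, ihT, ihU, vpair_zero]

theorem Tr.den_letPair (I : Interp S) {Γ : List Ty} {T U R : Ty} (C : Tr S Γ (.prod T U))
    (D : Tr S (U :: T :: .prod T U :: Γ) R) (γ : DEnv Γ) :
    (Tr.letPair C D).den I γ = (C.den I γ).bind fun c =>
      D.den I (DEnv.cons (vsnd c) (DEnv.cons (vfst c) (DEnv.cons c γ))) := by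
  simp only [Tr.letPair, Tr.den_letin, Tr.den_fst, Tr.den_snd, Tr.den_var, Part.map_some,
    Part.bind_some]
  rfl

theorem Tr.den_addT (I : Interp S) {T : Ty} {Γ : List Ty} {C D : Tr S Γ T} {γ : DEnv Γ}
    {a b : T.Den} (hC : C.den I γ = Part.some a) (hD : D.den I γ = Part.some b) :
    (Tr.addT T C D).den I γ = Part.some (a + b) := by
  induction T generalizing Γ with
  | real => simp only [Tr.addT, Tr.den_add, hC, hD, Part.bind_some]
  | unit =>
    simp only [Tr.addT, Tr.den_letin, Tr.den_rename, DEnv.comap_wk1, hC, hD, Part.bind_some,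
      Tr.den_unit]
    exact congrArg _ (funext fun i => i.elim0)
  | prod T U ihT ihU =>
    have hw : ∀ (c : (Ty.prod T U).Den) (d : T.Den) (e : U.Den),
        (DEnv.cons e (DEnv.cons d (DEnv.cons c γ))).comap (wk3 _ _ _) = γ := fun _ _ _ => rfl
    simp only [Tr.addT, Tr.den_letPair, Tr.den_rename, hw, hC, hD, Part.bind_some, Tr.den_pair]
    rw [ihT (a := vfst a) (b := vfst b) rfl rfl, ihU (a := vsnd a) (b := vsnd b) rfl rfl]
    simp only [Part.bind_some]
    rw [vpair_add, vpair_vfst_vsnd, vpair_vfst_vsnd]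

/-- `z` is the reverse-mode derivative of `f` at `x`, applied to `y`: near `x` the partial function
`f` is a total function, differentiable at `x`, and `z` is the image of `y` under the adjoint of its
derivative. -/
def HasRevDeriv {n m : ℕ} (f : PF n m) (x : RV n) (y : RV m) (z : RV n) : Prop :=
  ∃ (h : RV n → RV m) (h' : RV n →L[ℝ] RV m), HasFDerivAt h h' x ∧
    (∀ᶠ a in 𝓝 x, f a = Part.some (h a)) ∧ ∀ v, z ⬝ᵥ v = y ⬝ᵥ h' v

theorem HasRevDeriv.revDeriv_eq {n m : ℕ} {f : PF n m} {x : RV n} {y : RV m} {z : RV n}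
    (H : HasRevDeriv f x y z) : f.revDeriv x y = Part.some z := by
  obtain ⟨h, h', hh, he, hz⟩ := H
  rw [PF.revDeriv_of_hasFDerivAt hh he]
  congr 1
  funext j
  have := hz (Pi.single j 1)
  rw [dotProduct_single_one] at this
  rw [this, dotProduct]
  exact Finset.sum_congr rfl fun i _ => mul_comm _ _

/-- A partial function with a differentiable germ has reverse-mode derivatives. -/
theorem HasRevDeriv.exists {n m : ℕ} {f : PF n m} {x : RV n} {h : RV n → RV m}
    {h' : RV n →L[ℝ] RV m} (hh : HasFDerivAt h h' x) (he : ∀ᶠ a in 𝓝 x, f a = Part.some (h a))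
    (y : RV m) : ∃ z, HasRevDeriv f x y z := by
  refine ⟨fun j => ∑ i, h' (Pi.single j 1) i * y i, h, h', hh, he, fun v => ?_⟩
  have hv : ∀ i, h' v i = ∑ j, v j * h' (Pi.single j 1) i := fun i => by
    conv_lhs => rw [pi_eq_sum_univ' v]
    simp
  simp only [dotProduct, hv, Finset.sum_mul, Finset.mul_sum]
  rw [Finset.sum_comm]
  exact Finset.sum_congr rfl fun i _ => Finset.sum_congr rfl fun j _ => by ring

/-- The derivative in `HasRevDeriv` may be computed from any germ of the function. -/
theorem HasRevDeriv.dotProduct_eq {n m : ℕ} {f : PF n m} {x : RV n} {y : RV m} {z : RV n}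
    (H : HasRevDeriv f x y z) {h : RV n → RV m} {h' : RV n →L[ℝ] RV m} (hh : HasFDerivAt h h' x)
    (he : ∀ᶠ a in 𝓝 x, f a = Part.some (h a)) (v : RV n) : z ⬝ᵥ v = y ⬝ᵥ h' v := by
  obtain ⟨k, k', hk, ke, hz⟩ := H
  have hkh : k =ᶠ[𝓝 x] h := by
    filter_upwards [he, ke] with a h₁ h₂ using Part.some_injective (h₂.symm.trans h₁)
  rw [hz, hk.unique (hh.congr_of_eventuallyEq hkh)]

theorem vpair_dotProduct {T U : Ty} (a a' : T.Den) (b b' : U.Den) :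
    vpair a b ⬝ᵥ vpair a' b' = a ⬝ᵥ a' + b ⬝ᵥ b' := by
  simp only [dotProduct]
  refine (Fin.sum_univ_add _).trans ?_
  simp [vpair]

theorem EnvSmoothAt.comap {E : Type} [NormedAddCommGroup E] [NormedSpace ℝ E] {Γ Δ : List Ty}
    {g : E → DEnv Δ} {x₀ : E} (hg : EnvSmoothAt g x₀) (θ : Ren Γ Δ) :
    EnvSmoothAt (fun x => (g x).comap θ) x₀ := fun T v => hg T (θ T v)

theorem DEnv.comap_lift_comp {Δ Γ Γ' : List Ty} {T : Ty} (ν : Ren Γ Γ') (θ : Ren Δ (T :: Γ))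
    (a : T.Den) (γ : DEnv Γ') :
    (DEnv.cons a γ).comap (fun U v => ν.lift T U (θ U v)) = (DEnv.cons a (γ.comap ν)).comap θ := by
  rw [← DEnv.comap_lift]
  rfl

/-- Correctness of symbolic differentiation for `C`: wherever `C` is defined, the trace term
`W.R_V(x. C)` denotes the reverse-mode derivative of `C` in `x`.  The environments are related by a
renaming, as in `Tr.sdiffAux`. -/
def Tr.SDiffCorrect (I : Interp S) {Δ : List Ty} {U : Ty} (C : Tr S Δ U) : Prop :=
  ∀ {Γ : List Ty} {T : Ty} (θ : Ren Δ (T :: Γ)) (V : Val Γ T) (W : Val Γ U) (γ : DEnv Γ),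
    (C.den I ((DEnv.cons (V.den γ) γ).comap θ)).Dom →
    ∃ z, (C.sdiffAux θ V W).den I γ = Part.some z ∧
      HasRevDeriv (fun a => C.den I ((DEnv.cons a γ).comap θ)) (V.den γ) (W.den γ) z

/-- Symbolic differentiation in a larger environment, which extends the present one by bound
variables that do not occur in the trace term. -/
theorem Tr.SDiffCorrect.weaken {I : Interp S} {Δ : List Ty} {U : Ty} {C : Tr S Δ U}
    (H : C.SDiffCorrect I) {Γ Γ' : List Ty} {T : Ty} (θ : Ren Δ (T :: Γ)) (V : Val Γ T)
    (γ : DEnv Γ) (hd : (C.den I ((DEnv.cons (V.den γ) γ).comap θ)).Dom)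
    (ν : Ren Γ Γ') (γ' : DEnv Γ') (hγ : γ'.comap ν = γ) (W : Val Γ' U) :
    ∃ z, (C.sdiffAux (fun _ v => ν.lift T _ (θ _ v)) (V.rename ν) W).den I γ' = Part.some z ∧
      HasRevDeriv (fun a => C.den I ((DEnv.cons a γ).comap θ)) (V.den γ) (W.den γ') z := by
  subst hγ
  have := H (fun _ v => ν.lift T _ (θ _ v)) (V.rename ν) W γ'
  simp only [DEnv.comap_lift_comp, Val.den_rename] at this
  exact this hd

theorem Tr.sdiffCorrect_op (I : Interp S) {Δ : List Ty} {A B : Ty} (o : S.Op A B) {D : Tr S Δ A}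
    (ihD : D.SDiffCorrect I) : (Tr.op o D).SDiffCorrect I := by
  intro Γ T θ V W γ hd
  obtain ⟨d, hD, hd⟩ := exists_of_bind_dom hd
  change D.den I _ = _ at hD
  obtain ⟨k, hk, ke⟩ := PF.smooth_iff.1 (I.op_smooth o) _ hd
  have hkd := (hk.differentiableAt (by simp)).hasFDerivAt
  -- `y` is the value of `op_r⟨D, W⟩`
  obtain ⟨y, hy⟩ := HasRevDeriv.exists hkd ke (W.den γ)
  obtain ⟨z, h₁, m, m', hm, me, hz⟩ := ihD.weaken θ V γ (Part.eq_some_iff.1 hD).1 (wk2 T A)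
    (DEnv.cons y (DEnv.cons (V.den γ) γ)) rfl (.var .z)
  obtain rfl : m (V.den γ) = d := Part.some_injective (me.self_of_nhds.symm.trans hD)
  refine ⟨z, ?_, k ∘ m, (fderiv ℝ k (m (V.den γ))).comp m', hkd.comp _ hm, ?_, fun v => ?_⟩
  · simp only [Tr.sdiffAux, Tr.den_letin, Tr.den_val, Part.bind_some, Tr.den_op, Tr.den_pair,
      Tr.den_rename, hD, Val.den_rename, DEnv.comap_wk1, I.op_rev, hy.revDeriv_eq, h₁]
  · filter_upwards [me, hm.continuousAt.eventually ke] with a e₁ e₂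
    simp only [Tr.den_op, e₁, e₂, Part.bind_some, Function.comp_apply]
  · exact (hz v).trans (hy.dotProduct_eq hkd ke _)

theorem Tr.sdiffCorrect_letin (I : Interp S) {Δ : List Ty} {A B : Ty} {D : Tr S Δ A}
    {E : Tr S (A :: Δ) B} (ihD : D.SDiffCorrect I) (ihE : E.SDiffCorrect I) :
    (Tr.letin D E).SDiffCorrect I := by
  intro Γ T θ V W γ hd
  set x₀ := V.den γ with hx₀
  obtain ⟨d, hD, hE⟩ := exists_of_bind_dom hd
  change D.den I _ = _ at hD
  change (E.den I _).Dom at hE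
  -- `H` is the germ of the body, jointly in the bound variable and in `x`
  obtain ⟨H, hH, He⟩ := E.den_smooth I (x₀ := (d, x₀))
    (g := fun q : A.Den × T.Den => DEnv.cons q.1 ((DEnv.cons q.2 γ).comap θ))
    (EnvSmoothAt.cons_fst (((EnvSmoothAt.const γ x₀).cons contDiffAt_id).comap θ)) hE
  have hH := (hH.differentiableAt (by simp)).hasFDerivAt
  set H' := fderiv ℝ H (d, x₀)
  set γ₂ := DEnv.cons d (DEnv.cons x₀ γ) with hγ₂
  have hV : (V.rename (wk2 T A)).den γ₂ = x₀ := V.den_rename _ _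
  have hW : (W.rename (wk2 T A)).den γ₂ = W.den γ := W.den_rename _ _
  -- the partial derivative in the direction of `x`
  obtain ⟨θ₁, hθ₁⟩ : ∃ θ₁ : Ren (A :: Δ) (T :: A :: T :: Γ), θ₁ = fun
      | _, .z => .s .z
      | _, .s v => (wk2 T A).lift T _ (θ _ v) := ⟨_, rfl⟩
  have hγ₁ : ∀ a : T.Den, (DEnv.cons a γ₂).comap θ₁ = DEnv.cons d ((DEnv.cons a γ).comap θ) := by
    intro a
    funext U v
    cases v with
    | z => rw [hθ₁]; rfl
    | s v =>
      rw [hθ₁]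
      change DEnv.cons a γ₂ _ ((wk2 T A).lift T _ (θ _ v)) = DEnv.cons a γ _ (θ _ v)
      cases θ _ v <;> rfl
  have hz₁ := ihE θ₁ (V.rename (wk2 T A)) (W.rename (wk2 T A)) γ₂
  simp only [hγ₁, hV, hW] at hz₁
  obtain ⟨z₁, h₁, hz₁⟩ := hz₁ hE
  -- the partial derivative in the direction of the bound variable
  have hy := ihE (fun _ v => (wk1 A).lift A _ (θ.lift A _ v)) (.var .z) (W.rename (wk2 T A)) γ₂
  have hγ₂' : γ₂.comap (wk1 A) = DEnv.cons x₀ γ := rfl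
  simp only [DEnv.comap_lift_comp, DEnv.comap_lift, hγ₂', hW] at hy
  obtain ⟨y, hy₁, hy⟩ := hy hE
  change HasRevDeriv _ d _ _ at hy
  obtain ⟨z₂, h₂, m, m', hm, me, hz₂⟩ := ihD.weaken θ V γ (Part.eq_some_iff.1 hD).1 (wk3 T A A)
    (DEnv.cons y γ₂) rfl (.var .z)
  change ∀ v, z₂ ⬝ᵥ v = y ⬝ᵥ m' v at hz₂
  -- by the chain rule, the derivative in `x` of `H (m x, x)` is the sum of the two contributions
  obtain rfl : m x₀ = d := Part.some_injective (me.self_of_nhds.symm.trans hD)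
  have hinr : HasFDerivAt (fun a : T.Den => (m x₀, a)) (ContinuousLinearMap.inr ℝ A.Den T.Den) x₀ :=
    (hasFDerivAt_const (m x₀) x₀).prodMk (hasFDerivAt_id x₀)
  have hinl : HasFDerivAt (fun a : A.Den => (a, x₀)) (ContinuousLinearMap.inl ℝ A.Den T.Den)
      (m x₀) := (hasFDerivAt_id (m x₀)).prodMk (hasFDerivAt_const x₀ (m x₀))
  have hpair : HasFDerivAt (fun a : T.Den => (m a, a)) (m'.prod (.id ℝ T.Den)) x₀ :=
    hm.prodMk (hasFDerivAt_id x₀)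
  refine ⟨z₁ + z₂, ?_, _, _,
    HasFDerivAt.comp (g := H) (f := fun a : T.Den => (m a, a)) x₀ hH hpair, ?_, fun v => ?_⟩
  · subst hθ₁
    simp only [Tr.sdiffAux, Tr.den_letin, Tr.den_val, Part.bind_some, Tr.den_rename]
    rw [← hx₀, hD, Part.bind_some]
    refine Tr.den_addT I h₁ ?_
    rw [Tr.den_letin, hy₁, Part.bind_some, h₂]
  · filter_upwards [me, hpair.continuousAt.eventually He] with a e₁ e₂
    simp only [Tr.den_letin, e₁, Part.bind_some]
    exact e₂
  · have e₁ := hz₁.dotProduct_eq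
      (HasFDerivAt.comp (g := H) (f := fun a : T.Den => (m x₀, a)) x₀ hH hinr)
      (hinr.continuousAt.eventually He) v
    have e₂ := hy.dotProduct_eq
      (HasFDerivAt.comp (g := H) (f := fun a : A.Den => (a, x₀)) (m x₀) hH hinl)
      (hinl.continuousAt.eventually He) (m' v)
    have e₃ : H' (m' v, v) = H' (0, v) + H' (m' v, 0) := by
      rw [← map_add]; simp
    rw [add_dotProduct, hz₂ v, e₁, e₂]
    exact (dotProduct_add _ _ _).symm.trans (congrArg _ e₃.symm)

theorem Tr.sdiffCorrect_pair (I : Interp S) {Δ : List Ty} {A B : Ty} {D : Tr S Δ A}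
    {E : Tr S Δ B} (ihD : D.SDiffCorrect I) (ihE : E.SDiffCorrect I) :
    (Tr.pair D E).SDiffCorrect I := by
  intro Γ T θ V W γ hd
  obtain ⟨d, hD, hd⟩ := exists_of_bind_dom hd
  obtain ⟨e, hE, -⟩ := exists_of_bind_dom hd
  let γ₃ := DEnv.cons (vsnd (W.den γ)) (DEnv.cons (vfst (W.den γ)) (DEnv.cons (W.den γ) γ))
  obtain ⟨z₁, h₁, k₁, k₁', hk₁, ke₁, hz₁⟩ := ihD.weaken θ V γ (Part.eq_some_iff.1 hD).1
    (wk3 (.prod A B) A B) γ₃ rfl (.var (.s .z))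
  obtain ⟨z₂, h₂, k₂, k₂', hk₂, ke₂, hz₂⟩ := ihE.weaken θ V γ (Part.eq_some_iff.1 hE).1
    (wk3 (.prod A B) A B) γ₃ rfl (.var .z)
  refine ⟨z₁ + z₂, ?_, fun a => vpair (k₁ a) (k₂ a), (vpairL A B).comp (k₁'.prod k₂'),
    HasFDerivAt.comp (g := vpairL A B) _ (vpairL A B).hasFDerivAt (hk₁.prodMk hk₂), ?_,
    fun v => ?_⟩
  · simp only [Tr.sdiffAux, Tr.den_letPair, Tr.den_val, Part.bind_some]
    exact Tr.den_addT I h₁ h₂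
  · filter_upwards [ke₁, ke₂] with a e₁ e₂
    simp only [Tr.den_pair, e₁, e₂, Part.bind_some]
  · rw [add_dotProduct, hz₁, hz₂, ← vpair_vfst_vsnd (W.den γ)]
    exact (vpair_dotProduct _ _ _ _).symm

theorem Tr.sdiffCorrect_fst (I : Interp S) {Δ : List Ty} {A B : Ty} {D : Tr S Δ (.prod A B)}
    (ihD : D.SDiffCorrect I) : (Tr.fst D).SDiffCorrect I := by
  intro Γ T θ V W γ hd
  obtain ⟨d, hD⟩ := exists_some_of_dom (p := D.den I ((DEnv.cons (V.den γ) γ).comap θ)) hd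
  obtain ⟨z, h, k, k', hk, ke, hz⟩ := ihD.weaken θ V γ (Part.eq_some_iff.1 hD).1
    (wk2 T (.prod A B)) (DEnv.cons d (DEnv.cons (V.den γ) γ)) rfl
    (.pair (W.rename (wk2 T (.prod A B))) (Val.zero B))
  refine ⟨z, ?_, fun a => vfst (k a), (vfstL A B).comp k',
    HasFDerivAt.comp (g := vfstL A B) _ (vfstL A B).hasFDerivAt hk, ?_, fun v => ?_⟩
  · simp only [Tr.sdiffAux, Tr.den_letin, Tr.den_val, Part.bind_some, Tr.den_rename, hD, h]
  · filter_upwards [ke] with a e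
    simp only [Tr.den_fst, e, Part.map_some]
  · rw [hz, Val.den, Val.den_zero, Val.den_rename, ← vpair_vfst_vsnd (k' v), vpair_dotProduct,
      zero_dotProduct, add_zero]
    rfl

theorem Tr.sdiffCorrect_snd (I : Interp S) {Δ : List Ty} {A B : Ty} {D : Tr S Δ (.prod A B)}
    (ihD : D.SDiffCorrect I) : (Tr.snd D).SDiffCorrect I := by
  intro Γ T θ V W γ hd
  obtain ⟨d, hD⟩ := exists_some_of_dom (p := D.den I ((DEnv.cons (V.den γ) γ).comap θ)) hd
  obtain ⟨z, h, k, k', hk, ke, hz⟩ := ihD.weaken θ V γ (Part.eq_some_iff.1 hD).1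
    (wk2 T (.prod A B)) (DEnv.cons d (DEnv.cons (V.den γ) γ)) rfl
    (.pair (Val.zero A) (W.rename (wk2 T (.prod A B))))
  refine ⟨z, ?_, fun a => vsnd (k a), (vsndL A B).comp k',
    HasFDerivAt.comp (g := vsndL A B) _ (vsndL A B).hasFDerivAt hk, ?_, fun v => ?_⟩
  · simp only [Tr.sdiffAux, Tr.den_letin, Tr.den_val, Part.bind_some, Tr.den_rename, hD, h]
  · filter_upwards [ke] with a e
    simp only [Tr.den_snd, e, Part.map_some]
  · rw [hz, Val.den, Val.den_zero, Val.den_rename, ← vpair_vfst_vsnd (k' v), vpair_dotProduct,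
      zero_dotProduct, zero_add]
    rfl

theorem Tr.sdiffCorrect (I : Interp S) {Δ : List Ty} {U : Ty} (C : Tr S Δ U) :
    C.SDiffCorrect I := by
  induction C with
  | var v =>
    intro Γ T θ V W γ _
    simp only [Tr.sdiffAux, Tr.den_var, DEnv.comap]
    generalize θ _ v = v'
    cases v' with
    | z =>
      exact ⟨_, W.den_toTm I _ γ, id, .id ℝ _, hasFDerivAt_id _,
        Filter.Eventually.of_forall fun _ => rfl, fun _ => rfl⟩
    | s v' =>
      refine ⟨0, ?_, _, 0, hasFDerivAt_const (γ _ v') _,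
        Filter.Eventually.of_forall fun _ => rfl, fun _ => by simp⟩
      exact ((Val.zero T).den_toTm I _ γ).trans (by rw [Val.den_zero])
  | real r =>
    intro Γ T θ V W γ _
    refine ⟨0, ?_, _, 0, hasFDerivAt_const (vreal r) _,
      Filter.Eventually.of_forall fun _ => rfl, fun _ => by simp⟩
    exact ((Val.zero T).den_toTm I _ γ).trans (by rw [Val.den_zero])
  | unit =>
    intro Γ T θ V W γ _
    refine ⟨0, ?_, _, 0, hasFDerivAt_const vstar _,
      Filter.Eventually.of_forall fun _ => rfl, fun _ => by simp⟩
    exact ((Val.zero T).den_toTm I _ γ).trans (by rw [Val.den_zero])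
  | add D E ihD ihE =>
    intro Γ T θ V W γ hd
    obtain ⟨d, hD, hd⟩ := exists_of_bind_dom hd
    obtain ⟨e, hE, -⟩ := exists_of_bind_dom hd
    obtain ⟨z₁, h₁, k₁, k₁', hk₁, ke₁, hz₁⟩ := ihD θ V W γ (Part.eq_some_iff.1 hD).1
    obtain ⟨z₂, h₂, k₂, k₂', hk₂, ke₂, hz₂⟩ := ihE θ V W γ (Part.eq_some_iff.1 hE).1
    refine ⟨z₁ + z₂, Tr.den_addT I h₁ h₂, k₁ + k₂, k₁' + k₂', hk₁.add hk₂, ?_, fun v => ?_⟩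
    · filter_upwards [ke₁, ke₂] with a e₁ e₂
      simp only [Tr.den_add, e₁, e₂, Part.bind_some]
      rfl
    · rw [add_dotProduct, hz₁, hz₂, ← dotProduct_add]
      rfl
  | op o D ihD => exact Tr.sdiffCorrect_op I o ihD
  | letin D E ihD ihE => exact Tr.sdiffCorrect_letin I ihD ihE
  | pair D E ihD ihE => exact Tr.sdiffCorrect_pair I ihD ihE
  | fst D ihD => exact Tr.sdiffCorrect_fst I ihD
  | snd D ihD => exact Tr.sdiffCorrect_snd I ihD

theorem Tr.den_sdiff (I : Interp S) {Γ : List Ty} {T U : Ty} (C : Tr S (T :: Γ) U) (V : Val Γ T)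
    (W : Val Γ U) (γ : DEnv Γ) (hd : (C.den I (DEnv.cons (V.den γ) γ)).Dom) :
    (C.sdiff V W).den I γ =
      PF.revDeriv (fun a => C.den I (DEnv.cons a γ)) (V.den γ) (W.den γ) := by
  obtain ⟨z, h, hz⟩ := C.sdiffCorrect I (fun _ v => v) V W γ hd
  exact h.trans hz.revDeriv_eq.symm

/-! ### Ordinary evaluation -/

/-- The denotation of a closed value or boolean value. -/
def Srt.valueDen : {s : Srt} → s.Value → s.Den
  | .ty _, V => Val.cden V
  | .bool, b => b

/-- `M` evaluates to a closed value whose denotation is the partial element `d`. -/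
def Evaluates {Φ : List (Ty × Ty)} {Γ : List Ty} {s : Srt} (φ : FEnv S Φ) (ρ : VEnv Γ)
    (M : Tm S Φ Γ s) (d : Part s.Den) : Prop :=
  ∃ w : s.Value, Eval S φ ρ M w ∧ d = Part.some (Srt.valueDen w)

section
variable {I : Interp S} {Φ : List (Ty × Ty)} {Γ : List Ty} {φ : FEnv S Φ} {ρ : VEnv Γ}
  {α : DFEnv Φ}

theorem Eval.of_subst_eq {T : Ty} {V : Val Γ T} {V' : ClosedVal T} (h : V.subst ρ = V') :
    Eval S (s := .ty T) φ ρ V.toTm V' :=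
  h ▸ Eval.val V

theorem Evaluates.val {T : Ty} (V : Val Γ T) :
    Evaluates φ ρ V.toTm (V.toTm.den I α ρ.den) :=
  ⟨V.subst ρ, .val V, by rw [Val.den_toTm, ← Val.cden_subst]; rfl⟩

theorem Evaluates.bval (b : Bool) : Evaluates φ ρ (.ofBool b) ((Tm.ofBool b).den I α ρ.den) :=
  ⟨b, .bval b, Tm.den_ofBool I b α ρ.den⟩

theorem Evaluates.add (V W : Val Γ .real) :
    Evaluates φ ρ (.add V.toTm W.toTm) ((Tm.add V.toTm W.toTm).den I α ρ.den) := by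
  obtain ⟨a, ha⟩ := ClosedVal.eq_real (V.subst ρ)
  obtain ⟨b, hb⟩ := ClosedVal.eq_real (W.subst ρ)
  refine ⟨.real (a + b), .add (.of_subst_eq ha) (.of_subst_eq hb), ?_⟩
  simp only [Tm.den, Val.den_toTm, Part.bind_some, ← Val.cden_subst, ha, hb]
  rfl

theorem Evaluates.fst {T U : Ty} (V : Val Γ (.prod T U)) :
    Evaluates φ ρ (.fst V.toTm) ((Tm.fst V.toTm).den I α ρ.den) := by
  obtain ⟨V₁, V₂, h⟩ := ClosedVal.eq_pair (V.subst ρ)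
  refine ⟨V₁, .fst (.of_subst_eq h), ?_⟩
  simp only [Tm.den, Val.den_toTm, Part.map_some, ← Val.cden_subst, h]
  exact congrArg Part.some (vfst_vpair _ _)

theorem Evaluates.snd {T U : Ty} (V : Val Γ (.prod T U)) :
    Evaluates φ ρ (.snd V.toTm) ((Tm.snd V.toTm).den I α ρ.den) := by
  obtain ⟨V₁, V₂, h⟩ := ClosedVal.eq_pair (V.subst ρ)
  refine ⟨V₂, .snd (.of_subst_eq h), ?_⟩
  simp only [Tm.den, Val.den_toTm, Part.map_some, ← Val.cden_subst, h]
  exact congrArg Part.some (vsnd_vpair _ _)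

theorem Evaluates.op {T U : Ty} (o : S.Op T U) (V : Val Γ T)
    (hd : ((Tm.op o V.toTm).den I α ρ.den).Dom) :
    Evaluates φ ρ (.op o V.toTm) ((Tm.op o V.toTm).den I α ρ.den) := by
  simp only [Tm.den, Val.den_toTm, Part.bind_some, ← Val.cden_subst, I.op_ev] at hd ⊢
  obtain ⟨W, hW⟩ := exists_some_of_dom (p := S.ev o (V.subst ρ)) hd
  refine ⟨W, .op (.val V) (Part.eq_some_iff.1 hW), ?_⟩
  rw [hW, Part.map_some]
  rfl

theorem Evaluates.pred {T : Ty} (p : S.Pred T) (V : Val Γ T)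
    (hd : ((Tm.pred p V.toTm).den I α ρ.den).Dom) :
    Evaluates φ ρ (.pred p V.toTm) ((Tm.pred p V.toTm).den I α ρ.den) := by
  simp only [Tm.den, Val.den_toTm, Part.bind_some, ← Val.cden_subst, I.pred_bev] at hd ⊢
  obtain ⟨b, hb⟩ := exists_some_of_dom hd
  exact ⟨b, .pred (.val V) (Part.eq_some_iff.1 hb), hb⟩

theorem Tm.den_letin_val {T U : Ty} (V : Val Γ T) (N : Tm S Φ (T :: Γ) (.ty U)) :
    (Tm.letin V.toTm N).den I α ρ.den = N.den I α (ρ.cons (V.subst ρ)).den := by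
  rw [Tm.den, Val.den_toTm, Part.bind_some, VEnv.den_cons, Val.cden_subst]

theorem Evaluates.letin {T U : Ty} (V : Val Γ T) (N : Tm S Φ (T :: Γ) (.ty U))
    (h : Evaluates φ (ρ.cons (V.subst ρ)) N (N.den I α (ρ.cons (V.subst ρ)).den)) :
    Evaluates φ ρ (.letin V.toTm N) ((Tm.letin V.toTm N).den I α ρ.den) := by
  rw [Tm.den_letin_val]
  obtain ⟨w, hw, he⟩ := h
  exact ⟨w, .letin (.val V) hw, he⟩

theorem Tm.den_ite_ofBool {T : Ty} (b : Bool) (M N : Tm S Φ Γ (.ty T)) :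
    (Tm.ite (.ofBool b) M N).den I α = (bif b then M else N).den I α := by
  funext γ
  cases b <;> simp [Tm.den, Tm.ofBool]

theorem Evaluates.ite {T : Ty} (b : Bool) (M N : Tm S Φ Γ (.ty T)) {d : Part T.Den}
    (h : Evaluates φ ρ (bif b then M else N) d) :
    Evaluates φ ρ (.ite (.ofBool b) M N) d := by
  obtain ⟨w, hw, he⟩ := h
  cases b with
  | true => exact ⟨w, .iteTrue hw, he⟩
  | false => exact ⟨w, .iteFalse hw, he⟩

/-- Evaluation of `E[R]`; the premise on `E[x]` is needed only if `E` is not just a hole. -/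
theorem Evaluates.ctx {T : Ty} {s : Srt} {E : ECtx S Φ Γ (.ty T) s} {R : Tm S Φ Γ (.ty T)}
    (hR : Redex R) (hd : ((E.plug R).den I α ρ.den).Dom)
    (h₁ : Evaluates φ ρ R (R.den I α ρ.den))
    (h₂ : E.Nontrivial → ∀ V : ClosedVal T, (E.plugVar.den I α (ρ.cons V).den).Dom →
      Evaluates φ (ρ.cons V) E.plugVar (E.plugVar.den I α (ρ.cons V).den)) :
    Evaluates φ ρ (E.plug R) ((E.plug R).den I α ρ.den) := by
  by_cases hE : E.Nontrivial
  · obtain ⟨V, hV, he⟩ := h₁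
    have hp : (E.plug R).den I α ρ.den = E.plugVar.den I α (ρ.cons V).den := by
      rw [ECtx.den_plug, he, Part.bind_some, VEnv.den_cons]
      rfl
    rw [hp] at hd ⊢
    obtain ⟨w, hw, he'⟩ := h₂ hE V hd
    exact ⟨w, .ctx hE hR hV hw, he'⟩
  · cases E
    case hole => exact h₁
    all_goals exact absurd trivial hE

theorem Evaluates.bctx {s : Srt} {E : ECtx S Φ Γ .bool s} {R : Tm S Φ Γ .bool}
    (hR : Redex R) (hd : ((E.plug R).den I α ρ.den).Dom)
    (h₁ : Evaluates φ ρ R (R.den I α ρ.den))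
    (h₂ : ∀ b : Bool, ((E.plug (.ofBool b)).den I α ρ.den).Dom →
      Evaluates φ ρ (E.plug (.ofBool b)) ((E.plug (.ofBool b)).den I α ρ.den)) :
    Evaluates φ ρ (E.plug R) ((E.plug R).den I α ρ.den) := by
  obtain ⟨b, hb, he⟩ := h₁
  have hp : (E.plug R).den I α ρ.den = (E.plug (.ofBool b)).den I α ρ.den := by
    rw [ECtx.den_plug_bool, he, Part.bind_some]
    rfl
  rw [hp] at hd ⊢
  obtain ⟨w, hw, he'⟩ := h₂ b hd
  exact ⟨w, .bctx hR hb hw, he'⟩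

theorem ECtx.dom_of_plug_dom {k s : Srt} {E : ECtx S Φ Γ k s} {R : Tm S Φ Γ k} {γ : DEnv Γ}
    (h : ((E.plug R).den I α γ).Dom) : (R.den I α γ).Dom := by
  cases k with
  | ty T =>
    rw [ECtx.den_plug] at h
    exact Part.Dom.of_bind h
  | bool =>
    rw [ECtx.den_plug_bool] at h
    exact Part.Dom.of_bind h

end

/-- Terms without recursive definitions, applications and derivatives evaluate whenever their
denotation is defined. -/
theorem evaluates_of_weight_eq_zero (I : Interp S) (n : ℕ) {Φ : List (Ty × Ty)} {Γ : List Ty}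
    {s : Srt} (M : Tm S Φ Γ s) (hn : M.weight 1 1 < n) (h0 : M.weight 0 1 = 0)
    (φ : FEnv S Φ) (ρ : VEnv Γ) (α : DFEnv Φ) (hd : (M.den I α ρ.den).Dom) :
    Evaluates φ ρ M (M.den I α ρ.den) := by
  induction n generalizing Γ s with
  | zero => omega
  | succ n ih =>
    cases M.decomposed with
    | val V => exact .val V
    | bval b => exact .bval b
    | plug E R hR =>
      rename_i k
      have hRd := ECtx.dom_of_plug_dom hd
      rw [ECtx.weight_plug] at hn h0
      have hR1 := hR.one_lt_size
      have hRe : Evaluates φ ρ R (R.den I α ρ.den) := by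
        cases hR with
        | add V W => exact .add V W
        | op o V => exact .op o V hRd
        | fst V => exact .fst V
        | snd V => exact .snd V
        | pred p V => exact .pred p V hRd
        | letin V N =>
          rw [Tm.den_letin_val] at hRd
          simp only [Tm.weight] at hn h0
          exact .letin V N (ih N (by omega) (by omega) _ hRd)
        | ite b M N =>
          rw [Tm.den_ite_ofBool] at hRd ⊢
          simp only [Tm.weight] at hn h0
          exact .ite b M N (ih _ (by cases b <;> simp only [cond] <;> omega)
            (by cases b <;> simp only [cond] <;> omega) ρ hRd)
        | letrec M N => simp only [Tm.weight] at h0; omega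
        | app f V => simp only [Tm.weight] at h0; omega
        | rd N V W => simp only [Tm.weight] at h0; omega
      cases k with
      | ty T =>
        exact .ctx hR hd hRe fun _ V => ih _ (by rw [ECtx.weight_plugVar]; omega)
          (by rw [ECtx.weight_plugVar]; omega) (ρ.cons V)
      | bool =>
        exact .bctx hR hd hRe fun b => ih _ (by rw [ECtx.weight_plug, Tm.weight_ofBool]; omega)
          (by rw [ECtx.weight_plug, Tm.weight_ofBool]; omega) ρ

theorem Tr.evaluates (I : Interp S) {Φ : List (Ty × Ty)} {Γ : List Ty} {T : Ty} (C : Tr S Γ T)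
    (φ : FEnv S Φ) (ρ : VEnv Γ) (hd : (C.den I ρ.den).Dom) :
    Evaluates φ ρ (C.toTm : Tm S Φ Γ (.ty T)) (C.den I ρ.den) := by
  have := evaluates_of_weight_eq_zero I _ (C.toTm : Tm S Φ Γ _) (Nat.lt_succ_self _)
    C.weight_toTm φ ρ (fun _ _ _ => ⊥)
  rw [Tr.den_toTm] at this
  exact this hd

/-! ### Adequacy of ordinary and symbolic evaluation -/

/-- The trace term `C` denotes the same function as `D` near `γ₀`, along all smooth families of
environments.  (As `DEnv Γ` is not a normed space, neighbourhoods of `γ₀` are probed by smooth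
families.) -/
def AgreeNear (I : Interp S) {Γ : List Ty} {T : Ty} (C : Tr S Γ T) (D : DEnv Γ → Part T.Den)
    (γ₀ : DEnv Γ) : Prop :=
  ∀ {E : Type} [NormedAddCommGroup E] [NormedSpace ℝ E] (g : E → DEnv Γ) (x₀ : E), g x₀ = γ₀ →
    EnvSmoothAt g x₀ → ∀ᶠ x in 𝓝 x₀, C.den I (g x) = D (g x)

theorem AgreeNear.eq {I : Interp S} {Γ : List Ty} {T : Ty} {C : Tr S Γ T}
    {D : DEnv Γ → Part T.Den} {γ₀ : DEnv Γ} (h : AgreeNear I C D γ₀) : C.den I γ₀ = D γ₀ :=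
  (h (E := ℝ) (fun _ => γ₀) 0 rfl (EnvSmoothAt.const γ₀ 0)).self_of_nhds

theorem AgreeNear.of_forall {I : Interp S} {Γ : List Ty} {T : Ty} {C : Tr S Γ T}
    {D : DEnv Γ → Part T.Den} {γ₀ : DEnv Γ} (h : ∀ γ, C.den I γ = D γ) : AgreeNear I C D γ₀ :=
  fun _ _ _ _ => Filter.Eventually.of_forall fun _ => h _

/-- `M` symbolically evaluates to a trace term that denotes the same function as `D` near the
current environment. -/
def Traces (I : Interp S) {Φ : List (Ty × Ty)} {Γ : List Ty} {T : Ty} (φ : FEnv S Φ) (ρ : VEnv Γ)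
    (M : Tm S Φ Γ (.ty T)) (D : DEnv Γ → Part T.Den) : Prop :=
  ∃ C : Tr S Γ T, SEval S φ ρ M C ∧ AgreeNear I C D ρ.den

/-- Ordinary evaluation of `M`, and symbolic evaluation if `M` is not a boolean term, succeed and
agree with `D`. -/
def Adequate (I : Interp S) {Φ : List (Ty × Ty)} {Γ : List Ty} (φ : FEnv S Φ) (ρ : VEnv Γ) :
    {s : Srt} → Tm S Φ Γ s → (DEnv Γ → Part s.Den) → Prop
  | .ty _, M, D => Evaluates φ ρ M (D ρ.den) ∧ Traces I φ ρ M D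
  | .bool, M, D => Evaluates φ ρ M (D ρ.den)

theorem Adequate.evaluates {I : Interp S} {Φ : List (Ty × Ty)} {Γ : List Ty} {φ : FEnv S Φ}
    {ρ : VEnv Γ} {s : Srt} {M : Tm S Φ Γ s} {D : DEnv Γ → Part s.Den} (h : Adequate I φ ρ M D) :
    Evaluates φ ρ M (D ρ.den) := by
  cases s with
  | ty T => exact h.1
  | bool => exact h

/-- The logical relation between closures and partial functions `f`: wherever `f` is defined, the
body of the closure evaluates, and agrees with `f`. -/
def Approximates (I : Interp S) : {T U : Ty} → Clo S T U → PF T.dim U.dim → Prop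
  | T, U, .mk φ M, f => ∀ V : ClosedVal T, (f V.cden).Dom →
      Adequate I (FEnv.cons (.mk φ M) φ) (VEnv.nil.cons V) M
        (fun γ : DEnv [T] => (f (γ T .z) : Part U.Den))

section
variable {I : Interp S} {Φ : List (Ty × Ty)} {Γ : List Ty} {φ : FEnv S Φ} {ρ : VEnv Γ}
  {α : DFEnv Φ}

theorem DEnv.nil_unique (γ : DEnv []) : γ = DEnv.nil := by
  funext T v
  nomatch v

theorem DEnv.eq_cons_nil {T : Ty} (γ : DEnv [T]) : γ = DEnv.cons (γ T .z) DEnv.nil := by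
  funext U v
  cases v with
  | z => rfl
  | s v => nomatch v

theorem VEnv.den_nil_cons {T : Ty} (V : ClosedVal T) :
    (VEnv.nil.cons V).den = DEnv.cons V.cden DEnv.nil := by
  rw [VEnv.den_cons, DEnv.nil_unique (VEnv.den _)]

/-- Terms that are themselves trace terms symbolically evaluate to themselves. -/
theorem Traces.self {T : Ty} (C : Tr S Γ T) (h : SEval S φ ρ C.toTm C) :
    Traces I φ ρ C.toTm (fun γ => C.toTm.den I α γ) :=
  ⟨C, h, AgreeNear.of_forall fun γ => (C.den_toTm I α γ).symm⟩

theorem Traces.letin {T U : Ty} (V : Val Γ T) (N : Tm S Φ (T :: Γ) (.ty U))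
    (h : Traces I φ (ρ.cons (V.subst ρ)) N (fun γ => N.den I α γ)) :
    Traces I φ ρ (.letin V.toTm N) (fun γ => (Tm.letin V.toTm N).den I α γ) := by
  obtain ⟨C, hC, hA⟩ := h
  refine ⟨.letin V.toTr C, .letin (.val V) hC, fun g x₀ hx hg => ?_⟩
  have := hA (fun x => DEnv.cons (V.den (g x)) (g x)) x₀
    (by rw [VEnv.den_cons, Val.cden_subst, hx]) (hg.cons (V.den_smooth hg))
  filter_upwards [this] with x h
  simpa only [Tr.den_letin, Tr.den_val, Tm.den, Val.den_toTm, Part.bind_some] using h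

theorem Traces.ite {T : Ty} (b : Bool) (M N : Tm S Φ Γ (.ty T)) {D : DEnv Γ → Part T.Den}
    (h : Traces I φ ρ (bif b then M else N) D) :
    Traces I φ ρ (.ite (.ofBool b) M N) D := by
  obtain ⟨C, hC, hA⟩ := h
  cases b with
  | true => exact ⟨C, .iteTrue hC, hA⟩
  | false => exact ⟨C, .iteFalse hC, hA⟩

/-- The trace of `E[R]` is a `let` whose two parts agree with `R` and with `E[x]`, near the current
environment and the value of `R`. -/
theorem Traces.ctx (hα : α.Smooth) {T U : Ty} {E : ECtx S Φ Γ (.ty T) (.ty U)}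
    {R : Tm S Φ Γ (.ty T)} (hR : Redex R) (hd : ((E.plug R).den I α ρ.den).Dom)
    (h₁ : Traces I φ ρ R (fun γ => R.den I α γ))
    (h₂ : E.Nontrivial → ∀ V : ClosedVal T, (E.plugVar.den I α (ρ.cons V).den).Dom →
      Traces I φ (ρ.cons V) E.plugVar (fun γ => E.plugVar.den I α γ)) :
    Traces I φ ρ (E.plug R) (fun γ => (E.plug R).den I α γ) := by
  by_cases hE : E.Nontrivial
  · obtain ⟨C, hC, hA⟩ := h₁
    have hRd := ECtx.dom_of_plug_dom hd
    -- the symbolic rule continues with the value of the trace `C` of `R`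
    obtain ⟨V, hV, he⟩ := C.evaluates I φ ρ (by rw [hA.eq]; exact hRd)
    rw [hA.eq] at he
    have hp : (E.plug R).den I α ρ.den = E.plugVar.den I α (ρ.cons V).den := by
      rw [ECtx.den_plug, he, Part.bind_some, VEnv.den_cons]
      rfl
    obtain ⟨D, hD, hB⟩ := h₂ hE V (hp ▸ hd)
    refine ⟨.letin C D, .ctx hE hR hC hV hD, fun g x₀ hg₀ hg => ?_⟩
    obtain ⟨h, hh, hRe⟩ := R.den_smooth I α hα g x₀ hg (by rw [hg₀]; exact hRd)
    have hx₀ : h x₀ = V.cden := Part.some_injective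
      (hRe.self_of_nhds.symm.trans ((congrArg (R.den I α) hg₀).trans he))
    have := hB (fun x => DEnv.cons (h x) (g x)) x₀ (by rw [VEnv.den_cons, hx₀, hg₀]) (hg.cons hh)
    filter_upwards [this, hRe, hA g x₀ hg₀ hg] with x e₁ e₂ e₃
    rw [Tr.den_letin, ECtx.den_plug, e₃, e₂, Part.bind_some, Part.bind_some, e₁]
  · cases E
    case hole => exact h₁
    all_goals exact absurd trivial hE

theorem Traces.bctx (hα : α.Smooth) {U : Ty} {E : ECtx S Φ Γ .bool (.ty U)}
    {R : Tm S Φ Γ .bool} (hR : Redex R) (hd : ((E.plug R).den I α ρ.den).Dom)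
    (h₁ : Evaluates φ ρ R (R.den I α ρ.den))
    (h₂ : ∀ b : Bool, ((E.plug (.ofBool b)).den I α ρ.den).Dom →
      Traces I φ ρ (E.plug (.ofBool b)) (fun γ => (E.plug (.ofBool b)).den I α γ)) :
    Traces I φ ρ (E.plug R) (fun γ => (E.plug R).den I α γ) := by
  have hRd := ECtx.dom_of_plug_dom hd
  obtain ⟨b, hb, he⟩ := h₁
  have hp : ∀ γ, R.den I α γ = Part.some b →
      (E.plug R).den I α γ = (E.plug (.ofBool b)).den I α γ := fun γ h => by
    rw [ECtx.den_plug_bool, h, Part.bind_some]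
  obtain ⟨C, hC, hA⟩ := h₂ b (hp _ he ▸ hd)
  refine ⟨C, .bctx hR hb hC, fun g x₀ hg₀ hg => ?_⟩
  obtain ⟨b', hRe⟩ := R.den_smooth I α hα g x₀ hg (by rw [hg₀]; exact hRd)
  obtain rfl : b' = b := Part.some_injective
    (hRe.self_of_nhds.symm.trans ((congrArg (R.den I α) hg₀).trans he))
  filter_upwards [hRe, hA g x₀ hg₀ hg] with x e₁ e₂
  rw [e₂, hp _ e₁]

/-- The derivative rule: the trace of `N` agrees with `N` near the point of differentiation, so
that its symbolic derivative denotes the derivative of `N`. -/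
theorem Traces.rd (hα : α.Smooth) {T U : Ty} {N : Tm S Φ (T :: Γ) (.ty U)} {V : Val Γ T}
    {W : Val Γ U} (hd : (N.den I α (ρ.cons (V.subst ρ)).den).Dom)
    (h : Traces I φ (ρ.cons (V.subst ρ)) N (fun γ => N.den I α γ)) :
    Traces I φ ρ (.rd N V.toTm W.toTm) (fun γ => (Tm.rd N V.toTm W.toTm).den I α γ) := by
  obtain ⟨C, hC, hA⟩ := h
  refine ⟨C.sdiff V W, .rd (.val V) hC, fun {E} _ _ g x₀ hg₀ hg => ?_⟩
  have hl := V.den_smooth hg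
  have hq₀ : DEnv.cons (V.den (g x₀)) (g x₀) = (ρ.cons (V.subst ρ)).den := by
    rw [VEnv.den_cons, Val.cden_subst, hg₀]
  have hq : EnvSmoothAt (fun q : T.Den × E => DEnv.cons q.1 (g q.2)) (V.den (g x₀), x₀) :=
    hg.cons_fst
  obtain ⟨H, -, hN⟩ := N.den_smooth I α hα _ _ hq (by rw [hq₀]; exact hd)
  have hct : Filter.Tendsto (fun x => (V.den (g x), x)) (𝓝 x₀) (𝓝 (V.den (g x₀), x₀)) :=
    (hl.prodMk contDiffAt_id).continuousAt
  filter_upwards [hct.eventually hN,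
    hct.eventually
      (hA (fun q : T.Den × E => DEnv.cons q.1 (g q.2)) _ hq₀ hq).eventually_nhds] with x e₁ e₂
  have e₃ : C.den I (DEnv.cons (V.den (g x)) (g x)) = N.den I α (DEnv.cons (V.den (g x)) (g x)) :=
    e₂.self_of_nhds
  rw [Tr.den_sdiff I C V W (g x) (by rw [e₃, e₁]; trivial)]
  simp only [Tm.den, Val.den_toTm, Part.bind_some]
  have hs : Filter.Tendsto (fun a : T.Den => (a, x)) (𝓝 (V.den (g x)))
      (𝓝 (V.den (g x), x)) := (continuous_id.prodMk continuous_const).continuousAt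
  exact PF.revDeriv_congr (hs.eventually e₂) _

theorem Adequate.rd (hα : α.Smooth) {T U : Ty} {N : Tm S Φ (T :: Γ) (.ty U)} {V : Val Γ T}
    {W : Val Γ U} (hd : ((Tm.rd N V.toTm W.toTm).den I α ρ.den).Dom)
    (h : (N.den I α (ρ.cons (V.subst ρ)).den).Dom →
      Traces I φ (ρ.cons (V.subst ρ)) N (fun γ => N.den I α γ)) :
    Adequate I φ ρ (.rd N V.toTm W.toTm) (fun γ => (Tm.rd N V.toTm W.toTm).den I α γ) := by
  have hN : (N.den I α (ρ.cons (V.subst ρ)).den).Dom := by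
    rw [VEnv.den_cons, Val.cden_subst]
    simp only [Tm.den, Val.den_toTm, Part.bind_some] at hd
    exact PF.dom_of_revDeriv_dom hd
  have ht := Traces.rd hα (W := W) hN (h hN)
  refine ⟨?_, ht⟩
  obtain ⟨C, hC, hA⟩ := ht
  obtain ⟨X, hX, he⟩ := C.evaluates I φ ρ (by rw [hA.eq]; exact hd)
  exact ⟨X, .rd hC hX, hA.eq.symm.trans he⟩

theorem Adequate.app {T U : Ty} {f : Var Φ (T, U)} {V : Val Γ T}
    (hf : Approximates I (φ T U f) (α T U f))
    (hd : ((Tm.app f V.toTm).den I α ρ.den).Dom) :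
    Adequate I φ ρ (.app f V.toTm) (fun γ => (Tm.app f V.toTm).den I α γ) := by
  obtain ⟨Φ', φ', M, hc⟩ : ∃ (Φ' : _) (φ' : FEnv S Φ') (M : Tm S ((T, U) :: Φ') [T] (.ty U)),
      φ T U f = .mk φ' M := by
    cases φ T U f with
    | mk φ' M => exact ⟨_, φ', M, rfl⟩
  have hden : ∀ γ, (Tm.app f V.toTm).den I α γ = α T U f (V.den γ) := fun γ => by
    simp only [Tm.den, Val.den_toTm, Part.bind_some]
  simp only [hden] at hd ⊢
  rw [hc] at hf
  obtain ⟨⟨w, hw, he⟩, C, hC, hA⟩ := hf (V.subst ρ) (by rwa [Val.cden_subst])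
  rw [← hc] at hw hC
  refine ⟨⟨w, .app hc (.val V) hw, ?_⟩, .letin V.toTr (C.rename (Ren.nil.lift T)),
    .app hc (.val V) hC, fun g x₀ hg₀ hg => ?_⟩
  · rw [← he, VEnv.den_nil_cons, Val.cden_subst]
    rfl
  · have := hA (fun x => DEnv.cons (V.den (g x)) DEnv.nil) x₀
      (by rw [VEnv.den_nil_cons, Val.cden_subst, hg₀])
      ((EnvSmoothAt.const DEnv.nil x₀).cons (V.den_smooth hg))
    filter_upwards [this] with x e
    rw [Tr.den_letin, Tr.den_val, Part.bind_some, Tr.den_rename, DEnv.comap_lift,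
      DEnv.nil_unique (DEnv.comap _ _), e]
    rfl

/-- A closure approximates the least fixed point it denotes, if it approximates the value of the
functional at each smooth partial function that it approximates: it then approximates all Kleene
iterates, and each point of the domain of the least fixed point has a neighbourhood where one of
the iterates is defined. -/
theorem Approximates.mu {T U : Ty} {M : Tm S ((T, U) :: Φ) [T] (.ty U)} (hα : α.Smooth)
    (hM : ∀ f : PF T.dim U.dim, f.Smooth → Approximates I (.mk φ M) f → ∀ V : ClosedVal T,
      (M.den I (DFEnv.cons f α) (VEnv.nil.cons V).den).Dom →
      Adequate I (FEnv.cons (.mk φ M) φ) (VEnv.nil.cons V) M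
        (fun γ => M.den I (DFEnv.cons f α) γ)) :
    Approximates I (.mk φ M) (mu (recFun I M α)) := by
  have hF := recFun_smoothContinuous I M hα
  have hit : ∀ k, Approximates I (.mk φ M) ((recFun I M α)^[k] ⊥) := by
    intro k
    induction k with
    | zero => exact fun V hV => hV.elim
    | succ k ih =>
      intro V hV
      rw [Function.iterate_succ_apply'] at hV ⊢
      have := hM _ (hF.iterate_smooth k) ih V (by rw [VEnv.den_nil_cons]; exact hV)
      convert this using 3 with γ
      conv_rhs => rw [DEnv.eq_cons_nil γ]
      rfl
  intro V hV
  have hsup := fun x => hF.isChainSup_mu x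
  obtain ⟨v, hv⟩ := Part.dom_iff_mem.1 hV
  obtain ⟨k, hk⟩ := ((hsup _).mem_iff v).1 hv
  have hkd := Part.dom_iff_mem.2 ⟨v, hk⟩
  have hnear := (hF.iterate_smooth k).eventually_eq_of_le (fun x => (hsup x).le k) hkd
  obtain ⟨⟨w, hw, he⟩, C, hC, hA⟩ := hit k V hkd
  refine ⟨⟨w, hw, hnear.self_of_nhds.trans he⟩, C, hC, fun g x₀ hg₀ hg => ?_⟩
  have hz : g x₀ T .z = V.cden := by rw [hg₀]; rfl
  have hc : Filter.Tendsto (fun x => g x T .z) (𝓝 x₀) (𝓝 V.cden) :=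
    hz ▸ (hg T .z).continuousAt
  filter_upwards [hA g x₀ hg₀ hg, hc.eventually hnear] with x e₁ e₂
  rw [e₁, e₂]

end

/-- The fundamental property of the logical relation. -/
theorem adequate_of_approximates (I : Interp S) (n : ℕ) {Φ : List (Ty × Ty)} {Γ : List Ty}
    {s : Srt} (M : Tm S Φ Γ s) (hn : M.weight 1 1 < n) (φ : FEnv S Φ) (ρ : VEnv Γ)
    (α : DFEnv Φ) (hα : α.Smooth) (hφ : ∀ T U f, Approximates I (φ T U f) (α T U f))
    (hd : (M.den I α ρ.den).Dom) :
    Adequate I φ ρ M (fun γ => M.den I α γ) := by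
  induction n generalizing Φ Γ s with
  | zero => omega
  | succ n ih =>
    cases M.decomposed with
    | val V => exact ⟨.val V, .self V.toTr (.val V)⟩
    | bval b => exact Evaluates.bval b
    | plug E R hR =>
      rename_i k
      have hRd := ECtx.dom_of_plug_dom hd
      rw [ECtx.weight_plug] at hn
      have hR1 := hR.one_lt_size
      have hRa : Adequate I φ ρ R (fun γ => R.den I α γ) := by
        cases hR with
        | add V W => exact ⟨.add V W, .self (.add V.toTr W.toTr) (.add V W)⟩
        | op o V => exact ⟨.op o V hRd, .self (.op o V.toTr) (.op o V)⟩
        | fst V => exact ⟨.fst V, .self (.fst V.toTr) (.fst V)⟩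
        | snd V => exact ⟨.snd V, .self (.snd V.toTr) (.snd V)⟩
        | pred p V => exact Evaluates.pred p V hRd
        | letin V N =>
          rw [Tm.den_letin_val] at hRd
          simp only [Tm.weight] at hn
          have := ih N (by omega) φ _ α hα hφ hRd
          exact ⟨.letin V N this.1, .letin V N this.2⟩
        | ite b M N =>
          simp only [Tm.den_ite_ofBool] at hRd ⊢
          simp only [Tm.weight] at hn
          have := ih _ (by cases b <;> simp only [cond] <;> omega) φ ρ α hα hφ hRd
          exact ⟨.ite b M N this.1, .ite b M N this.2⟩
        | @letrec A B _ M N =>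
          simp only [Tm.weight] at hn
          have hα' : ∀ f : PF A.dim B.dim, f.Smooth → (DFEnv.cons f α).Smooth :=
            fun f hf => hα.cons hf
          have hφ' : ∀ f, Approximates I (.mk φ M) f → ∀ T U v,
              Approximates I (FEnv.cons (.mk φ M) φ T U v) (DFEnv.cons f α T U v) := by
            intro f hf T U v
            cases v with
            | z => exact hf
            | s v => exact hφ T U v
          have hmu : Approximates I (.mk φ M) (mu (recFun I M α)) :=
            .mu hα fun f hf hc V => ih M (by omega) _ _ _ (hα' f hf) (hφ' f hc)
          obtain ⟨⟨w, hw, he⟩, C, hC, hA⟩ := ih N (by omega) _ ρ _ (hα' _ (mu_smooth _))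
            (hφ' _ hmu) hRd
          exact ⟨⟨w, .letrec hw, he⟩, C, .letrec hC, hA⟩
        | app f V => exact .app (hφ _ _ f) hRd
        | rd N V W =>
          simp only [Tm.weight] at hn
          exact .rd hα hRd fun h => (ih N (by omega) φ _ α hα hφ h).2
      cases k with
      | ty T =>
        have hE : ∀ V : ClosedVal T, (E.plugVar.den I α (ρ.cons V).den).Dom →
            Adequate I φ (ρ.cons V) E.plugVar (fun γ => E.plugVar.den I α γ) := fun V =>
          ih _ (by rw [ECtx.weight_plugVar]; omega) φ (ρ.cons V) α hα hφ
        have hev := Evaluates.ctx hR hd hRa.1 fun _ V h => (hE V h).evaluates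
        cases s with
        | ty U => exact ⟨hev, .ctx hα hR hd hRa.2 fun _ V h => (hE V h).2⟩
        | bool => exact hev
      | bool =>
        have hE : ∀ b : Bool, ((E.plug (.ofBool b)).den I α ρ.den).Dom →
            Adequate I φ ρ (E.plug (.ofBool b)) (fun γ => (E.plug (.ofBool b)).den I α γ) :=
          fun b => ih _ (by rw [ECtx.weight_plug, Tm.weight_ofBool]; omega) φ ρ α hα hφ
        have hev := Evaluates.bctx hR hd hRa fun b h => (hE b h).evaluates
        cases s with
        | ty U => exact ⟨hev, .bctx hα hR hd hRa fun b h => (hE b h).2⟩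
        | bool => exact hev

theorem Clo.den_smooth (I : Interp S) {T U : Ty} (c : Clo S T U) : (c.den I).Smooth := by
  cases c
  exact mu_smooth _

theorem FEnv.den_smooth (I : Interp S) {Φ : List (Ty × Ty)} (φ : FEnv S Φ) : (φ.den I).Smooth :=
  fun T U f => (φ T U f).den_smooth I

/-- Closures approximate their denotations. -/
theorem Clo.approximates_den (I : Interp S) {T U : Ty} (c : Clo S T U) :
    Approximates I c (c.den I) := by
  induction c with
  | mk φ M ih =>
    refine Approximates.mu (α := FEnv.den I φ) (FEnv.den_smooth I φ) fun f hf hc V =>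
      adequate_of_approximates I _ M (Nat.lt_succ_self _) _ _ _ ((FEnv.den_smooth I φ).cons hf) ?_
    intro T U v
    cases v with
    | z => exact hc
    | s v => exact ih T U v

/-- Terms evaluate, both ordinarily and symbolically, whenever their denotation is defined. -/
theorem Tm.adequate (I : Interp S) {Φ : List (Ty × Ty)} {Γ : List Ty} {s : Srt} (M : Tm S Φ Γ s)
    (φ : FEnv S Φ) (ρ : VEnv Γ) (hd : (M.den I (φ.den I) ρ.den).Dom) :
    Adequate I φ ρ M (fun γ => M.den I (φ.den I) γ) :=
  adequate_of_approximates I _ M (Nat.lt_succ_self _) φ ρ _ (FEnv.den_smooth I φ)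
    (fun T U f => (φ T U f).approximates_den I) hd

end

end DiffLang


theorem mainTheorem2 (S : DiffLang.Signature.{u}) (I : DiffLang.Interp S)
    (Φ : List (DiffLang.Ty × DiffLang.Ty)) (Γ : List DiffLang.Ty)
    (φ : DiffLang.FEnv S Φ) (ρ : DiffLang.VEnv Γ) :
    (∀ (T : DiffLang.Ty) (M : DiffLang.Tm S Φ Γ (.ty T)),
      (M.den I (φ.den I) ρ.den).Dom →
        ∃ V : DiffLang.ClosedVal T, DiffLang.Eval S (s := .ty T) φ ρ M V) ∧
    (∀ B : DiffLang.Tm S Φ Γ .bool,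
      (B.den I (φ.den I) ρ.den).Dom →
        ∃ b : Bool, DiffLang.Eval S (s := .bool) φ ρ B b) ∧
    (∀ (T : DiffLang.Ty) (M : DiffLang.Tm S Φ Γ (.ty T)),
      (M.den I (φ.den I) ρ.den).Dom →
        ∃ C : DiffLang.Tr S Γ T, DiffLang.SEval S φ ρ M C) := by
  refine ⟨fun T M hd => ?_, fun B hd => ?_, fun T M hd => ?_⟩
  · obtain ⟨V, hV, -⟩ := (M.adequate I φ ρ hd).evaluates
    exact ⟨V, hV⟩
  · obtain ⟨b, hb, -⟩ := (B.adequate I φ ρ hd).evaluates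
    exact ⟨b, hb⟩
  · obtain ⟨C, hC, -⟩ := (M.adequate I φ ρ hd).2
    exact ⟨C, hC⟩
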